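/- A tournament is a loopless digraph $T$ with exactly one arc between every two distinct vertices. A cycle of $T$ is a nonempty sequence $(v_1,\dots,v_r)$ of distinct vertices such that $(v_1,v_2),\dots,(v_{r-1},v_r),(v_r,v_1)$ are arcs of $T$; these are the arcs of the cycle. In the problem Arc-Disjoint Cycle Packing in Tournaments (ACT), the input is a tournament $T$ and a positive integer $k$, and the question is whether $T$ has $k$ pairwise arc-disjoint cycles. **Theorem.** ACT can be solved in $\mathcal{O}^\star(2^{\mathcal{O}(k^2\log k)})$ time. That is, there are a single deterministic algorithm, a function $g:\mathbb{N}\to\mathbb{N}$ with $g(k)=\mathcal{O}(k^2\log k)$ as $k\to\infty$, and a polynomial $P$, such that for every tournament $T$ with $n$ vertices and every positive integer $k$, the algorithm, given $(T,k)$, correctly decides in at most $2^{g(k)}\cdot P(n)$ steps whether $T$ has $k$ pairwise arc-disjoint cycles. (The algorithm is a program for a random access machine with addition, subtraction and indirect addressing at unit cost, whose input is $n$, $k$ and the adjacency matrix of $T$.) -/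

import Mathlib

open Filter Asymptotics

/-! ### Tournaments and arc-disjoint cycles -/

namespace ArcPacking

/-- A tournament: a loopless digraph with exactly one arc between any two distinct vertices. -/
def IsTournament {V : Type*} (D : Digraph V) : Prop :=
  (∀ v, ¬ D.Adj v v) ∧
    ∀ u v, u ≠ v → (D.Adj u v ∧ ¬ D.Adj v u) ∨ (D.Adj v u ∧ ¬ D.Adj u v)

/-- The arcs `(v₁, v₂), …, (vₘ₋₁, vₘ), (vₘ, v₁)` of the closed sequence `(v₁, …, vₘ)`. -/
def cycleArcs {V : Type*} (c : List V) : List (V × V) :=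
  c.zip (c.rotate 1)

/-- A (directed) cycle of `D`: a nonempty sequence of distinct vertices in which every vertex has
an arc to the next one, and the last vertex has an arc to the first one. -/
def IsCycle {V : Type*} (D : Digraph V) (c : List V) : Prop :=
  c ≠ [] ∧ c.Nodup ∧ ∀ e ∈ cycleArcs c, D.Adj e.1 e.2

/-- `D` has `k` cycles that are pairwise arc-disjoint. -/
def HasArcDisjointCycles {V : Type*} (D : Digraph V) (k : ℕ) : Prop :=
  ∃ C : Fin k → List V, (∀ i, IsCycle D (C i)) ∧
    ∀ i j, i ≠ j → List.Disjoint (cycleArcs (C i)) (cycleArcs (C j))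

/-! ### Random access machines

A random access machine has registers, addressed directly by the program, and a memory, accessed
through addresses held in registers. Each cell holds a natural number. A program is a finite
command and mentions finitely many registers. Every elementary instruction and every test costs one
step. The only arithmetic is addition and truncated subtraction (there is no multiplication), so
after `t` steps the numbers are at most `2 ^ t` times the largest number in the program and the
input, and unit cost is polynomially equivalent to logarithmic cost and to Turing machine time. -/

/-- A configuration: the contents of the registers and of the memory. -/
structure Store where
  reg : ℕ → ℕ
  mem : ℕ → ℕ

/-- Elementary instructions; the arguments `x y z` are names of registers. -/
inductive Instr where
  /-- `x := c` for a constant `c` -/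
  | const (x c : ℕ)
  /-- `x := y + z` -/
  | add (x y z : ℕ)
  /-- `x := y - z`, or `0` if `y < z` -/
  | sub (x y z : ℕ)
  /-- `x := mem[y]` -/
  | load (x y : ℕ)
  /-- `mem[x] := y` -/
  | store (x y : ℕ)

/-- The effect of an elementary instruction. -/
def Instr.exec : Instr → Store → Store
  | .const x c, s => { s with reg := Function.update s.reg x c }
  | .add x y z, s => { s with reg := Function.update s.reg x (s.reg y + s.reg z) }
  | .sub x y z, s => { s with reg := Function.update s.reg x (s.reg y - s.reg z) }
  | .load x y, s => { s with reg := Function.update s.reg x (s.mem (s.reg y)) }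
  | .store x y, s => { s with mem := Function.update s.mem (s.reg x) (s.reg y) }

/-- Programs. -/
inductive Prog where
  /-- the empty program -/
  | skip
  /-- an elementary instruction -/
  | instr (i : Instr)
  /-- sequential composition -/
  | seq (p q : Prog)
  /-- `if x ≠ 0 then p else q` -/
  | ite (x : ℕ) (p q : Prog)
  /-- `while x ≠ 0 do p` -/
  | loop (x : ℕ) (p : Prog)

/-- `Runs p s t s'`: the program `p`, started in `s`, halts in `s'` after exactly `t` steps. -/
inductive Runs : Prog → Store → ℕ → Store → Prop
  | skip (s : Store) : Runs .skip s 0 s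
  | instr (i : Instr) (s : Store) : Runs (.instr i) s 1 (i.exec s)
  | seq {p q : Prog} {s s' s'' : Store} {t u : ℕ} :
      Runs p s t s' → Runs q s' u s'' → Runs (.seq p q) s (t + u) s''
  | ite_true {x : ℕ} {p q : Prog} {s s' : Store} {t : ℕ} :
      s.reg x ≠ 0 → Runs p s t s' → Runs (.ite x p q) s (t + 1) s'
  | ite_false {x : ℕ} {p q : Prog} {s s' : Store} {t : ℕ} :
      s.reg x = 0 → Runs q s t s' → Runs (.ite x p q) s (t + 1) s'
  | loop_true {x : ℕ} {p : Prog} {s s' s'' : Store} {t u : ℕ} :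
      s.reg x ≠ 0 → Runs p s t s' → Runs (.loop x p) s' u s'' →
        Runs (.loop x p) s (t + u + 1) s''
  | loop_false {x : ℕ} {p : Prog} {s : Store} :
      s.reg x = 0 → Runs (.loop x p) s 1 s

/-- The machine is deterministic: running time and final configuration are unique. -/
theorem Runs.unique {p : Prog} {s s₁ s₂ : Store} {t₁ t₂ : ℕ}
    (h₁ : Runs p s t₁ s₁) (h₂ : Runs p s t₂ s₂) : t₁ = t₂ ∧ s₁ = s₂ := by
  induction h₁ generalizing t₂ s₂ with
  | skip s => cases h₂; exact ⟨rfl, rfl⟩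
  | instr i s => cases h₂; exact ⟨rfl, rfl⟩
  | seq _ _ ih₁ ih₂ =>
    cases h₂ with
    | seq a b =>
      obtain ⟨rfl, rfl⟩ := ih₁ a
      obtain ⟨rfl, rfl⟩ := ih₂ b
      exact ⟨rfl, rfl⟩
  | ite_true hx _ ih =>
    cases h₂ with
    | ite_true _ a => obtain ⟨rfl, rfl⟩ := ih a; exact ⟨rfl, rfl⟩
    | ite_false hx' _ => exact absurd hx' hx
  | ite_false hx _ ih =>
    cases h₂ with
    | ite_true hx' _ => exact absurd hx hx'
    | ite_false _ a => obtain ⟨rfl, rfl⟩ := ih a; exact ⟨rfl, rfl⟩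
  | loop_true hx _ _ ih₁ ih₂ =>
    cases h₂ with
    | loop_true _ a b =>
      obtain ⟨rfl, rfl⟩ := ih₁ a
      obtain ⟨rfl, rfl⟩ := ih₂ b
      exact ⟨rfl, rfl⟩
    | loop_false hx' => exact absurd hx' hx
  | loop_false hx =>
    cases h₂ with
    | loop_true hx' _ _ => exact absurd hx hx'
    | loop_false _ => exact ⟨rfl, rfl⟩

/-! ### The decision problem -/

open Classical in
/-- The input `(D, k)`: register `0` holds the number `n` of vertices, register `1` holds `k`, and
the memory holds the adjacency matrix of `D` row by row. All other cells hold `0`. -/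
noncomputable def inputStore {n : ℕ} (D : Digraph (Fin n)) (k : ℕ) : Store where
  reg x := if x = 0 then n else if x = 1 then k else 0
  mem a := if ∃ i j : Fin n, a = i.val * n + j.val ∧ D.Adj i j then 1 else 0

/-- The program `p` solves Arc-Disjoint Cycle Packing in Tournaments within time `τ n k`: on every
tournament with `n` vertices and every positive integer `k` it halts after at most `τ n k` steps,
with `1` in register `0` if there are `k` arc-disjoint cycles, and with `0` there otherwise. -/
def SolvesACT (p : Prog) (τ : ℕ → ℕ → ℕ) : Prop :=
  ∀ (n : ℕ) (D : Digraph (Fin n)) (k : ℕ), IsTournament D → 0 < k →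
    ∃ (t : ℕ) (s : Store), Runs p (inputStore D k) t s ∧ t ≤ τ n k ∧
      (HasArcDisjointCycles D k → s.reg 0 = 1) ∧
      (¬ HasArcDisjointCycles D k → s.reg 0 = 0)

end ArcPacking

/-! Choose triangles greedily, accepting one if at most one of its vertices lies in triangles
accepted before. Accepted triangles are arc-disjoint, so `k` of them settle the question
(`IsTable.hasArcDisjointCycles`). Otherwise their vertices form a set S, the hub, with at most 3k
elements, and every triangle has at least two vertices in S (`IsTable.isHub`).

This makes the rest of the tournament rigid: if u and v lie outside S and u → v → w, then u → w. So
the tournament is transitive outside S, out-neighbourhoods into S are nested, and vertices outside S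
with the same out-degree into S are twins with respect to S. They form at most |S| + 1 classes, each
linearly ordered. The kernel consists of S and the first M vertices of every class; any M vertices
can be mapped into it with arcs preserved (`IsHub.exists_map`).

The choice M = k(2k+3) suffices, because a packing of minimum total length has only cycles of length
at most 2k+3 (`exists_short_packing`): in a longer cycle, at least 2k+1 chords at one vertex would
all be used by the packing, whereas `k` cycles have at most 2k arcs at a vertex. The kernel has
O(k³) vertices and a packing is written with k(2k+4) digits in that base, so that 2^O(k² log k)
candidates have to be tested (`IsTable.hasCode_iff`).

On the machine side, `Comp` collects the functions computable in time polynomial in a declared size.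
It is closed under bounded iteration, hence under arithmetic and bounded quantifiers. The exhaustive
search fits into this calculus because the size in `kernelCtx` includes the bound on the number of
candidates. -/

namespace ArcPacking

/-! ### Reasoning about programs -/

/-- Started in `s`, the program `p` halts within `T` steps in a configuration satisfying `Q`. -/
def Does (p : Prog) (s : Store) (T : ℕ) (Q : Store → Prop) : Prop :=
  ∃ t s', Runs p s t s' ∧ t ≤ T ∧ Q s'

theorem Does.mono {p : Prog} {s : Store} {T T' : ℕ} {Q Q' : Store → Prop}
    (h : Does p s T Q) (hT : T ≤ T') (hQ : ∀ s', Q s' → Q' s') : Does p s T' Q' := by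
  obtain ⟨t, s', hr, ht, hq⟩ := h
  exact ⟨t, s', hr, ht.trans hT, hQ _ hq⟩

theorem Does.instr {i : Instr} {s : Store} {Q : Store → Prop} (h : Q (i.exec s)) :
    Does (.instr i) s 1 Q :=
  ⟨1, _, .instr i s, le_rfl, h⟩

theorem Does.seq {p q : Prog} {s : Store} {T U : ℕ} {Q : Store → Prop}
    (h : Does p s T fun s' => Does q s' U Q) : Does (.seq p q) s (T + U) Q := by
  obtain ⟨t, s', hr, ht, u, s'', hr', hu, hq⟩ := h
  exact ⟨t + u, s'', .seq hr hr', add_le_add ht hu, hq⟩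

theorem Does.ite {x : ℕ} {p q : Prog} {s : Store} {T : ℕ} {Q : Store → Prop}
    (h₁ : s.reg x ≠ 0 → Does p s T Q) (h₂ : s.reg x = 0 → Does q s T Q) :
    Does (.ite x p q) s (T + 1) Q := by
  by_cases hx : s.reg x = 0
  · obtain ⟨t, s', hr, ht, hq⟩ := h₂ hx
    exact ⟨t + 1, s', .ite_false hx hr, by omega, hq⟩
  · obtain ⟨t, s', hr, ht, hq⟩ := h₁ hx
    exact ⟨t + 1, s', .ite_true hx hr, by omega, hq⟩

/-- A loop whose body decreases the register `x` by one, with an invariant indexed by the number of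
remaining iterations. -/
theorem Does.loop {x : ℕ} {p : Prog} {T : ℕ} (I : ℕ → Store → Prop)
    (hx : ∀ r s, I r s → s.reg x = r)
    (hp : ∀ r s, I (r + 1) s → Does p s T (I r)) (r : ℕ) (s : Store) (hs : I r s) :
    Does (.loop x p) s (r * (T + 1) + 1) (I 0) := by
  induction r generalizing s with
  | zero => exact ⟨1, s, .loop_false (hx _ _ hs), by omega, hs⟩
  | succ r ih =>
    obtain ⟨t, s', hr, ht, hq⟩ := hp r s hs
    obtain ⟨u, s'', hr', hu, hq'⟩ := ih s' hq
    refine ⟨t + u + 1, s'', .loop_true (by rw [hx _ _ hs]; omega) hr hr', ?_, hq'⟩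
    rw [Nat.succ_mul]
    omega

/-! ### Contexts and polynomially bounded functions -/

/-- A family of machine states indexed by `α`: `m` variables, the memory, and a bound on the size of
all numbers. -/
structure Ctx (α : Type) where
  m : ℕ
  var : α → ℕ → ℕ
  mem : α → ℕ → ℕ
  size : α → ℕ
  var_le : ∀ a x, x < m → var a x ≤ size a
  mem_le : ∀ a y, mem a y ≤ size a

/-- The context with one more variable. -/
def Ctx.ext {α : Type} (Γ : Ctx α) : Ctx (α × ℕ) where
  m := Γ.m + 1
  var p x := if x = Γ.m then p.2 else Γ.var p.1 x
  mem p := Γ.mem p.1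
  size p := max (Γ.size p.1) p.2
  var_le p x hx := by
    split_ifs with h
    · exact le_max_right _ _
    · exact (Γ.var_le _ _ (by omega)).trans (le_max_left _ _)
  mem_le p y := (Γ.mem_le _ _).trans (le_max_left _ _)

/-- `f` is bounded by a polynomial in the size. -/
def PolyBdd {α : Type} (Γ : Ctx α) (f : α → ℕ) : Prop :=
  ∃ q, ∀ a, f a ≤ (Γ.size a + 2) ^ q

section PolyBdd

variable {α : Type} {Γ : Ctx α} {f g : α → ℕ}

theorem PolyBdd.mono (hg : PolyBdd Γ g) (h : ∀ a, f a ≤ g a) : PolyBdd Γ f :=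
  hg.imp fun _ hq a => (h a).trans (hq a)

/-- The base of the bounding power is at least 2, so c < 2 ^ c shows that the exponent c is enough.
-/
theorem PolyBdd.const (c : ℕ) : PolyBdd Γ fun _ => c :=
  ⟨c, fun a => (Nat.lt_two_pow_self (n := c)).le.trans (Nat.pow_le_pow_left (by omega) c)⟩

theorem PolyBdd.size : PolyBdd Γ Γ.size := ⟨1, fun a => by rw [pow_one]; omega⟩

theorem PolyBdd.mul (hf : PolyBdd Γ f) (hg : PolyBdd Γ g) : PolyBdd Γ fun a => f a * g a := by
  obtain ⟨q, hq⟩ := hf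
  obtain ⟨r, hr⟩ := hg
  exact ⟨q + r, fun a => by rw [pow_add]; exact Nat.mul_le_mul (hq a) (hr a)⟩

theorem PolyBdd.add (hf : PolyBdd Γ f) (hg : PolyBdd Γ g) : PolyBdd Γ fun a => f a + g a := by
  obtain ⟨q, hq⟩ := hf
  obtain ⟨r, hr⟩ := hg
  refine ⟨q + r + 1, fun a => ?_⟩
  have h1 : (Γ.size a + 2) ^ q ≤ (Γ.size a + 2) ^ (q + r) :=
    Nat.pow_le_pow_right (by omega) (by omega)
  have h2 : (Γ.size a + 2) ^ r ≤ (Γ.size a + 2) ^ (q + r) :=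
    Nat.pow_le_pow_right (by omega) (by omega)
  have h3 : (Γ.size a + 2) ^ (q + r) * 2 ≤ (Γ.size a + 2) ^ (q + r + 1) := by
    rw [pow_succ]; exact Nat.mul_le_mul_left _ (by omega)
  have h4 := hq a
  have h5 := hr a
  change f a + g a ≤ _
  omega

/-- Polynomially bounded functions of one more argument that is itself polynomially bounded. -/
theorem PolyBdd.subst {F : α × ℕ → ℕ} (hF : PolyBdd Γ.ext F) (hf : PolyBdd Γ f) :
    ∃ G, PolyBdd Γ G ∧ ∀ a i, i ≤ f a → F (a, i) ≤ G a := by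
  obtain ⟨q, hq⟩ := hF
  obtain ⟨r, hr⟩ := PolyBdd.add (PolyBdd.add PolyBdd.size (PolyBdd.const 2)) hf
  refine ⟨fun a => (Γ.size a + 2) ^ (r * q), ⟨r * q, fun a => le_rfl⟩, fun a i hi => ?_⟩
  refine (hq (a, i)).trans ?_
  beta_reduce
  rw [pow_mul]
  refine Nat.pow_le_pow_left (le_trans ?_ (hr a)) q
  have : max (Γ.size a) i ≤ Γ.size a + f a := max_le (by omega) (by omega)
  change max (Γ.size a) i + 2 ≤ Γ.size a + 2 + f a
  omega

end PolyBdd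

/-! ### Computable functions -/

/-- The configuration `s` has the variables of the context in the registers given by `ρ`. -/
def Ctx.Matches {α : Type} (Γ : Ctx α) (ρ : ℕ → ℕ) (a : α) (s : Store) : Prop :=
  (∀ x < Γ.m, s.reg (ρ x) = Γ.var a x) ∧ s.mem = Γ.mem a

/-- The configuration `s'` arises from `s` by changing registers not below `d` only. -/
def SameBelow (d : ℕ) (s s' : Store) : Prop :=
  s'.mem = s.mem ∧ ∀ x < d, s'.reg x = s.reg x

theorem SameBelow.trans {d e : ℕ} {s s' s'' : Store} (h : SameBelow d s s')
    (h' : SameBelow e s' s'') (hde : d ≤ e) : SameBelow d s s'' :=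
  ⟨h'.1.trans h.1, fun x hx => (h'.2 x (by omega)).trans (h.2 x hx)⟩

theorem SameBelow.update {d x : ℕ} (s : Store) (v : ℕ) (hx : d ≤ x) :
    SameBelow d s { s with reg := Function.update s.reg x v } :=
  ⟨rfl, fun y hy => Function.update_of_ne (by omega) _ _⟩

theorem Ctx.Matches.of_same {α : Type} {Γ : Ctx α} {ρ : ℕ → ℕ} {a : α} {s s' : Store} {d : ℕ}
    (h : Γ.Matches ρ a s) (hs : SameBelow d s s') (hρ : ∀ x < Γ.m, ρ x < d) :
    Γ.Matches ρ a s' :=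
  ⟨fun x hx => (hs.2 _ (hρ x hx)).trans (h.1 x hx), hs.1.trans h.2⟩

theorem Ctx.Matches.ext {α : Type} {Γ : Ctx α} {ρ : ℕ → ℕ} {a : α} {s : Store} {y i : ℕ}
    (h : Γ.Matches ρ a s) (hy : s.reg y = i) :
    Γ.ext.Matches (Function.update ρ Γ.m y) (a, i) s := by
  refine ⟨fun x hx => ?_, h.2⟩
  change x < Γ.m + 1 at hx
  by_cases hxm : x = Γ.m
  · subst hxm
    simp [Ctx.ext, hy]
  · rw [Function.update_of_ne hxm]
    simp only [Ctx.ext, hxm, if_false]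
    exact h.1 x (by omega)

/-- `p` computes `f` into register `d` within time `T`, without changing the memory or the registers
below `d`. -/
def Computes {α : Type} (Γ : Ctx α) (ρ : ℕ → ℕ) (f : α → ℕ) (d : ℕ) (p : Prog) (T : α → ℕ) :
    Prop :=
  ∀ a s, Γ.Matches ρ a s → Does p s (T a) fun s' => s'.reg d = f a ∧ SameBelow d s s'

/-- `f` is polynomially bounded and computable in polynomial time, in terms of the size. -/
def Comp {α : Type} (Γ : Ctx α) (f : α → ℕ) : Prop :=
  PolyBdd Γ f ∧ ∃ T, PolyBdd Γ T ∧
    ∀ d ρ, (∀ x < Γ.m, ρ x < d) → ∃ p, Computes Γ ρ f d p T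

namespace Comp

variable {α : Type} {Γ : Ctx α} {f g : α → ℕ}

/-- There is no move instruction: a register is copied by clearing the target and adding to it. -/
theorem var {x : ℕ} (hx : x < Γ.m) : Comp Γ fun a => Γ.var a x := by
  refine ⟨PolyBdd.mono PolyBdd.size fun a => Γ.var_le a x hx, fun _ => 2, PolyBdd.const _,
    fun d ρ hρ => ⟨.seq (.instr (.const d 0)) (.instr (.add d (ρ x) d)), fun a s hs => ?_⟩⟩
  refine Does.seq (T := 1) (U := 1) (Does.instr (Does.instr ⟨?_, ?_⟩))
  · have := hρ x hx
    simp [Instr.exec, Function.update_of_ne this.ne, hs.1 x hx]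
  · exact (SameBelow.update _ _ le_rfl).trans (SameBelow.update _ _ le_rfl) le_rfl

theorem const (c : ℕ) : Comp Γ fun _ => c := by
  refine ⟨PolyBdd.const c, fun _ => 1, PolyBdd.const _,
    fun d ρ hρ => ⟨.instr (.const d c), fun a s hs => ?_⟩⟩
  refine Does.instr ⟨?_, SameBelow.update _ _ le_rfl⟩
  simp [Instr.exec]

/-- Combining two computed values by one instruction. -/
theorem binary (op : ℕ → ℕ → ℕ) (i : ℕ → Instr)
    (hi : ∀ d s, (i d).exec s =
      { s with reg := Function.update s.reg d (op (s.reg d) (s.reg (d + 1))) })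
    (hop : PolyBdd Γ fun a => op (f a) (g a)) (hf : Comp Γ f) (hg : Comp Γ g) :
    Comp Γ fun a => op (f a) (g a) := by
  obtain ⟨-, T, hT, hp⟩ := hf
  obtain ⟨-, U, hU, hq⟩ := hg
  refine ⟨hop, fun a => T a + (U a + 1), hT.add (hU.add (PolyBdd.const 1)), fun d ρ hρ => ?_⟩
  obtain ⟨p, hp⟩ := hp d ρ hρ
  obtain ⟨q, hq⟩ := hq (d + 1) ρ fun x hx => (hρ x hx).trans (by omega)
  refine ⟨.seq p (.seq q (.instr (i d))), fun a s hs => Does.seq ?_⟩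
  refine (hp a s hs).mono le_rfl fun s₁ h₁ => Does.seq ?_
  refine (hq a s₁ (hs.of_same h₁.2 hρ)).mono le_rfl fun s₂ h₂ => Does.instr ?_
  rw [hi]
  refine ⟨?_, (h₁.2.trans h₂.2 (by omega)).trans (SameBelow.update _ _ le_rfl) le_rfl⟩
  simp [h₂.1, h₂.2.2 d (by omega), h₁.1]

theorem add (hf : Comp Γ f) (hg : Comp Γ g) : Comp Γ fun a => f a + g a :=
  binary (· + ·) (fun d => .add d d (d + 1)) (fun _ _ => rfl) (hf.1.add hg.1) hf hg

theorem sub (hf : Comp Γ f) (hg : Comp Γ g) : Comp Γ fun a => f a - g a :=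
  binary (· - ·) (fun d => .sub d d (d + 1)) (fun _ _ => rfl)
    (hf.1.mono fun _ => Nat.sub_le _ _) hf hg

theorem load (hf : Comp Γ f) : Comp Γ fun a => Γ.mem a (f a) := by
  obtain ⟨-, T, hT, hp⟩ := hf
  refine ⟨PolyBdd.mono PolyBdd.size fun a => Γ.mem_le a _, fun a => T a + 1,
    hT.add (PolyBdd.const 1), fun d ρ hρ => ?_⟩
  obtain ⟨p, hp⟩ := hp d ρ hρ
  refine ⟨.seq p (.instr (.load d d)), fun a s hs => Does.seq ?_⟩
  refine (hp a s hs).mono le_rfl fun s₁ h₁ => Does.instr ?_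
  refine ⟨?_, h₁.2.trans (SameBelow.update _ _ le_rfl) le_rfl⟩
  simp [Instr.exec, h₁.1, h₁.2.1, hs.2]

theorem weaken (hf : Comp Γ f) : Comp Γ.ext fun p => f p.1 := by
  obtain ⟨⟨q, hq⟩, T, ⟨r, hr⟩, hp⟩ := hf
  refine ⟨⟨q, fun b => (hq _).trans (Nat.pow_le_pow_left ?_ _)⟩, fun b => T b.1,
    ⟨r, fun b => (hr _).trans (Nat.pow_le_pow_left ?_ _)⟩, fun d ρ hρ => ?_⟩
  · exact Nat.add_le_add_right (le_max_left _ _) 2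
  · exact Nat.add_le_add_right (le_max_left _ _) 2
  obtain ⟨p, hp⟩ := hp d ρ fun x hx => hρ x (Nat.lt_succ_of_lt hx)
  refine ⟨p, fun b s hs => hp b.1 s ⟨fun x hx => ?_, hs.2⟩⟩
  rw [hs.1 x (Nat.lt_succ_of_lt hx)]
  simp [Ctx.ext, hx.ne]

theorem top : Comp Γ.ext fun p => p.2 := by
  have := var (Γ := Γ.ext) (x := Γ.m) (Nat.lt_succ_self _)
  simpa [Ctx.ext] using this

/-- Bounded iteration. -/
theorem fold {e init : α → ℕ} {step : (α × ℕ) × ℕ → ℕ} (F : α → ℕ → ℕ) {B : α → ℕ}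
    (he : Comp Γ e) (hinit : Comp Γ init) (hstep : Comp Γ.ext.ext step) (hB : PolyBdd Γ B)
    (hF₀ : ∀ a, F a 0 = init a)
    (hF : ∀ a i, i < e a → F a (i + 1) = step ((a, i), F a i))
    (hFB : ∀ a i, i ≤ e a → F a i ≤ B a) :
    Comp Γ fun a => F a (e a) := by
  obtain ⟨hbe, Te, hTe, hpe⟩ := he
  obtain ⟨-, Ti, hTi, hpi⟩ := hinit
  obtain ⟨-, Ts, hTs, hps⟩ := hstep
  obtain ⟨B', hB', hBB'⟩ : ∃ B' : α × ℕ → ℕ, PolyBdd Γ.ext B' ∧ ∀ p, B' p = B p.1 := by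
    obtain ⟨q, hq⟩ := hB
    exact ⟨fun p => B p.1, ⟨q, fun p => (hq _).trans
      (Nat.pow_le_pow_left (Nat.add_le_add_right (le_max_left _ _) 2) _)⟩, fun _ => rfl⟩
  -- The time of one step depends on the round and on the accumulator. Inserting their bounds `B`
  -- and `e` gives a bound `H` in terms of the outer state alone.
  obtain ⟨G, hG, hGs⟩ := hTs.subst hB'
  obtain ⟨H, hH, hHs⟩ := hG.subst hbe
  refine ⟨hB.mono fun a => hFB a _ le_rfl,
    fun a => Ti a + (Te a + (1 + (1 + (e a * (H a + (1 + (1 + (1 + 1))) + 1) + 1)))), ?_, ?_⟩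
  · exact hTi.add (hTe.add ((PolyBdd.const 1).add ((PolyBdd.const 1).add
      ((hbe.mul ((hH.add (PolyBdd.const 4)).add (PolyBdd.const 1))).add (PolyBdd.const 1)))))
  intro d ρ hρ
  obtain ⟨pi, hpi⟩ := hpi d ρ hρ
  obtain ⟨pe, hpe⟩ := hpe (d + 1) ρ fun x hx => (hρ x hx).trans (by omega)
  obtain ⟨ps, hps⟩ := hps (d + 4)
    (Function.update (Function.update ρ Γ.m (d + 2)) (Γ.m + 1) d) (by
      intro x hx
      change x < Γ.m + 1 + 1 at hx
      simp only [Function.update_apply]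
      split_ifs
      · omega
      · omega
      · exact (hρ x (by omega)).trans (by omega))
  -- Registers: `d` accumulator, `d + 1` remaining rounds, `d + 2` current round, `d + 3` the
  -- constant 1, `d + 4` the result of the step.
  refine ⟨.seq pi (.seq pe (.seq (.instr (.const (d + 2) 0)) (.seq (.instr (.const (d + 3) 1))
    (.loop (d + 1) (.seq ps (.seq (.instr (.const d 0)) (.seq (.instr (.add d d (d + 4)))
      (.seq (.instr (.add (d + 2) (d + 2) (d + 3)))
        (.instr (.sub (d + 1) (d + 1) (d + 3))))))))))), fun a s hs => Does.seq ?_⟩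
  refine (hpi a s hs).mono le_rfl fun s₁ h₁ => Does.seq ?_
  have hs₁ := hs.of_same h₁.2 hρ
  refine (hpe a s₁ hs₁).mono le_rfl fun s₂ h₂ => Does.seq (Does.instr (Does.seq (Does.instr ?_)))
  refine (Does.loop (fun r s' => r ≤ e a ∧ s'.reg d = F a (e a - r) ∧ s'.reg (d + 1) = r ∧
      s'.reg (d + 2) = e a - r ∧ s'.reg (d + 3) = 1 ∧ SameBelow d s s') (T := H a + 4)
      (fun r s' h => h.2.2.1) ?_ (e a) _ ?_).mono le_rfl ?_
  · rintro r s' ⟨hr, hd, hd1, hd2, hd3, hsame⟩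
    refine Does.seq ?_
    have hm : Γ.ext.ext.Matches _ ((a, e a - (r + 1)), F a (e a - (r + 1))) s' :=
      ((hs.of_same hsame hρ).ext (y := d + 2) hd2).ext (y := d) hd
    refine (hps _ s' hm).mono ?_ fun s'' h'' => ?_
    · refine (hGs (a, e a - (r + 1)) _ ?_).trans (hHs a _ (by omega))
      rw [hBB']
      exact hFB a _ (by omega)
    · refine Does.seq (T := 1) (U := 1 + (1 + 1)) (Does.instr (Does.seq (Does.instr (Does.seq
        (Does.instr (Does.instr ?_))))))
      have e1 := h''.2.2 (d + 1) (by omega)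
      have e2 := h''.2.2 (d + 2) (by omega)
      have e3 := h''.2.2 (d + 3) (by omega)
      have hlt : e a - (r + 1) + 1 = e a - r := by omega
      refine ⟨by omega, ?_, ?_, ?_, ?_, ?_⟩
      · simp [Instr.exec, h''.1, ← hF a _ (show e a - (r + 1) < e a by omega), hlt]
      · simp [Instr.exec, e1, e3, hd1, hd3]
      · simp [Instr.exec, e2, e3, hd2, hd3, hlt]
      · simp [Instr.exec, e3, hd3]
      · refine (hsame.trans (h''.2) (by omega)).trans (e := d) ?_ le_rfl
        exact (((SameBelow.update _ _ (by omega)).trans (SameBelow.update _ _ (by omega)) le_rfl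
          ).trans (SameBelow.update _ _ (by omega)) le_rfl).trans
            (SameBelow.update _ _ (by omega)) le_rfl
  · have hd := h₂.2.2 d (by omega)
    refine ⟨le_rfl, ?_, ?_, ?_, ?_, ?_⟩
    · simp [Instr.exec, hd, h₁.1, hF₀]
    · simp [Instr.exec, h₂.1]
    · simp [Instr.exec]
    · simp [Instr.exec]
    · exact ((h₁.2.trans h₂.2 (by omega)).trans (SameBelow.update _ _ (by omega)) le_rfl).trans
        (SameBelow.update _ _ (by omega)) le_rfl
  · rintro s' ⟨-, hd, -, -, -, hsame⟩
    exact ⟨by simpa using hd, hsame⟩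

end Comp

open Classical in
/-- The decidable predicate `P` is computable in polynomial time. -/
def CompP {α : Type} (Γ : Ctx α) (P : α → Prop) : Prop :=
  Comp Γ fun a => if P a then 1 else 0

/-! ### Closure properties: arithmetic, Boolean operations, bounded quantifiers -/

section

variable {α : Type} {Γ : Ctx α} {f g : α → ℕ} {P Q : α → Prop}

theorem Comp.of_eq (hf : Comp Γ f) (h : ∀ a, g a = f a) : Comp Γ g := by
  rwa [funext h]

theorem CompP.of_iff (hP : CompP Γ P) (h : ∀ a, Q a ↔ P a) : CompP Γ Q := by
  rwa [funext fun a => propext (h a)]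

theorem Comp.sum {b : α → ℕ → ℕ} (hf : Comp Γ f) (hb : Comp Γ.ext fun p => b p.1 p.2) :
    Comp Γ fun a => ∑ i ∈ Finset.range (f a), b a i := by
  obtain ⟨G, hG, hGb⟩ := hb.1.subst hf.1
  refine Comp.fold (B := fun a => f a * G a) (fun a i => ∑ j ∈ Finset.range i, b a j) hf
    (Comp.const 0) (Comp.add Comp.top hb.weaken) (hf.1.mul hG) (fun a => by simp)
    (fun a i _ => by rw [Finset.sum_range_succ, add_comm]) fun a i hi => ?_
  refine (Finset.sum_le_card_nsmul _ _ (G a) fun j hj => hGb a j ?_).trans ?_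
  · have := Finset.mem_range.1 hj
    omega
  · simpa using Nat.mul_le_mul_right _ hi

/-- The machine cannot multiply; a product is a sum of equal terms. -/
theorem Comp.mul (hf : Comp Γ f) (hg : Comp Γ g) : Comp Γ fun a => f a * g a :=
  (Comp.sum (b := fun a _ => g a) hf hg.weaken).of_eq fun a => by simp

theorem CompP.not (hP : CompP Γ P) : CompP Γ fun a => ¬ P a :=
  Comp.of_eq ((Comp.const 1).sub hP) fun a => by by_cases h : P a <;> simp [h]

theorem CompP.and (hP : CompP Γ P) (hQ : CompP Γ Q) : CompP Γ fun a => P a ∧ Q a :=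
  Comp.of_eq (Comp.mul hP hQ) fun a => by by_cases h : P a <;> by_cases h' : Q a <;> simp [h, h']

theorem CompP.or (hP : CompP Γ P) (hQ : CompP Γ Q) : CompP Γ fun a => P a ∨ Q a :=
  (hP.not.and hQ.not).not.of_iff fun _ => by tauto

/-- With truncated subtraction, 1 - (1 - x) is the indicator of x ≠ 0, here for x = g - f. -/
theorem CompP.lt (hf : Comp Γ f) (hg : Comp Γ g) : CompP Γ fun a => f a < g a :=
  Comp.of_eq ((Comp.const 1).sub ((Comp.const 1).sub (hg.sub hf))) fun a => by
    split_ifs <;> omega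

theorem CompP.le (hf : Comp Γ f) (hg : Comp Γ g) : CompP Γ fun a => f a ≤ g a :=
  (CompP.lt hg hf).not.of_iff fun _ => not_lt.symm

theorem CompP.eq (hf : Comp Γ f) (hg : Comp Γ g) : CompP Γ fun a => f a = g a :=
  ((CompP.le hf hg).and (CompP.le hg hf)).of_iff fun _ => le_antisymm_iff

theorem Comp.ite [DecidablePred P] (hP : CompP Γ P) (hf : Comp Γ f) (hg : Comp Γ g) :
    Comp Γ fun a => if P a then f a else g a :=
  ((Comp.mul hP hf).add (Comp.mul hP.not hg)).of_eq fun a => by by_cases h : P a <;> simp [h]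

theorem Comp.count {P : α → ℕ → Prop} [∀ a, DecidablePred (P a)] (hf : Comp Γ f)
    (hP : CompP Γ.ext fun p => P p.1 p.2) :
    Comp Γ fun a => ((Finset.range (f a)).filter (P a)).card :=
  (Comp.sum hf (b := fun a i => @_root_.ite _ (P a i) (Classical.propDecidable _) 1 0) hP).of_eq
    fun a => by
      rw [Finset.card_filter]
      exact Finset.sum_congr rfl fun i _ => by by_cases h : P a i <;> simp [h]

theorem CompP.exists_lt {P : α → ℕ → Prop} (hf : Comp Γ f) (hP : CompP Γ.ext fun p => P p.1 p.2) :
    CompP Γ fun a => ∃ i < f a, P a i := by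
  classical
  refine (CompP.lt (Comp.const 0) (Comp.count hf hP)).of_iff fun a => ?_
  simp [Finset.card_pos, Finset.Nonempty]

theorem CompP.forall_lt {P : α → ℕ → Prop} (hf : Comp Γ f) (hP : CompP Γ.ext fun p => P p.1 p.2) :
    CompP Γ fun a => ∀ i < f a, P a i :=
  (CompP.exists_lt (P := fun a i => ¬ P a i) hf hP.not).not.of_iff fun _ => by push Not; rfl

theorem Comp.div (hf : Comp Γ f) (hg : Comp Γ g) : Comp Γ fun a => f a / g a := by
  classical
  -- The quotient counts the positive multiples of the divisor up to `f a`; the condition `0 < g a`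
  -- reproduces the convention x / 0 = 0.
  refine (Comp.count (P := fun a i => 0 < g a ∧ (i + 1) * g a ≤ f a) hf (CompP.and
    (CompP.lt (Comp.const 0) hg.weaken) (CompP.le (Comp.mul (Comp.add Comp.top (Comp.const 1))
      hg.weaken) hf.weaken))).of_eq fun a => ?_
  rcases Nat.eq_zero_or_pos (g a) with h | h
  · simp [h]
  · have : (Finset.range (f a)).filter (fun i => 0 < g a ∧ (i + 1) * g a ≤ f a) =
        Finset.range (f a / g a) := by
      ext i
      simp only [Finset.mem_filter, Finset.mem_range, h, true_and]
      rw [← Nat.le_div_iff_mul_le h]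
      have := Nat.div_le_self (f a) (g a)
      omega
    rw [this, Finset.card_range]

theorem Comp.mod (hf : Comp Γ f) (hg : Comp Γ g) : Comp Γ fun a => f a % g a :=
  (hf.sub (hg.mul (hf.div hg))).of_eq fun _ => Nat.mod_eq_sub_mul_div

/-- The digit at position `p` of `c` in base `b`. -/
def digit (b c p : ℕ) : ℕ := c / b ^ p % b

/-- Repeated division keeps every intermediate value at most `g a`. The power of the base, which
need not be polynomially bounded, is never formed. -/
theorem Comp.digit {h : α → ℕ} (hf : Comp Γ f) (hg : Comp Γ g) (hh : Comp Γ h) :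
    Comp Γ fun a => digit (f a) (g a) (h a) := by
  refine Comp.mod (Comp.fold (B := g) (fun a i => g a / f a ^ i) hh hg
    (Comp.div Comp.top hf.weaken.weaken) hg.1 (fun a => by simp) (fun a i _ => ?_)
      fun a i _ => Nat.div_le_self _ _) hf
  rw [pow_succ, Nat.div_div_eq_div_mul]

theorem Comp.pow (hf : Comp Γ f) (hg : Comp Γ g) (h : PolyBdd Γ fun a => f a ^ g a) :
    Comp Γ fun a => f a ^ g a := by
  -- The summand 1 covers base 0, where the initial power 0 ^ 0 = 1 can exceed the final one.
  refine Comp.fold (B := fun a => f a ^ g a + 1) (fun a i => f a ^ i) hg (Comp.const 1)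
    (Comp.mul Comp.top hf.weaken.weaken) (h.add (PolyBdd.const 1)) (fun a => pow_zero _)
    (fun a i _ => pow_succ _ _) fun a i hi => ?_
  rcases Nat.eq_zero_or_pos (f a) with h0 | h0
  · rcases Nat.eq_zero_or_pos i with h1 | h1
    · simp [h1]
    · simp [h0, h1.ne']
  · exact (Nat.pow_le_pow_right h0 hi).trans (Nat.le_succ _)

end

/-! ### Filling a table -/

/-- Memories that hold bits. -/
abbrev BitMem : Type := {m : ℕ → ℕ // ∀ y, m y ≤ 1}

/-- The states with `n` as only variable and bits in the memory. -/
def vertexCtx : Ctx (ℕ × BitMem) where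
  m := 1
  var a _ := a.1
  mem a := a.2.1
  size a := a.1 + 1
  var_le _ _ _ := Nat.le_succ _
  mem_le a y := (a.2.2 y).trans (by omega)

/-- The states with variables `n` and `k` and bits in the memory. -/
def instanceCtx : Ctx (ℕ × ℕ × BitMem) where
  m := 2
  var a x := if x = 0 then a.1 else a.2.1
  mem a := a.2.2.1
  size a := a.1 + a.2.1 + 1
  var_le _ _ _ := by split_ifs <;> omega
  mem_le a y := (a.2.2.2 y).trans (by omega)

open Classical in
/-- The memory after `t` rounds in which the bit at the address `b + i` becomes the truth value of
`P`, evaluated on the current memory and the round `i`. -/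
noncomputable def fillTable (P : (ℕ → ℕ) → ℕ → Prop) (b : ℕ) (m : ℕ → ℕ) : ℕ → ℕ → ℕ
  | 0 => m
  | t + 1 => Function.update (fillTable P b m t) (b + t) (if P (fillTable P b m t) t then 1 else 0)

section fillTable

variable {P : (ℕ → ℕ) → ℕ → Prop} {b : ℕ} {m : ℕ → ℕ}

theorem fillTable_le (hm : ∀ y, m y ≤ 1) (t y : ℕ) : fillTable P b m t y ≤ 1 := by
  induction t with
  | zero => exact hm y
  | succ t ih =>
    simp only [fillTable, Function.update_apply]
    split_ifs <;> omega

theorem fillTable_of_lt {t y : ℕ} (h : y < b) : fillTable P b m t y = m y := by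
  induction t with
  | zero => rfl
  | succ t ih => rw [fillTable, Function.update_of_ne (by omega), ih]

theorem fillTable_stable {t u y : ℕ} (h : y < b + t) (htu : t ≤ u) :
    fillTable P b m u y = fillTable P b m t y := by
  induction u, htu using Nat.le_induction with
  | base => rfl
  | succ u hu ih => rw [fillTable, Function.update_of_ne (by omega), ih]

/-- If `P` depends only on the memory below the bit to be written, then the final table satisfies
the defining equivalence. -/
theorem fillTable_iff {t u : ℕ} (hP : ∀ m m', (∀ y < b + t, m y = m' y) → (P m t ↔ P m' t))
    (htu : t < u) : fillTable P b m u (b + t) ≠ 0 ↔ P (fillTable P b m u) t := by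
  rw [fillTable_stable (t := t + 1) (by omega) htu,
    hP _ (fillTable P b m t) fun y hy => fillTable_stable hy htu.le]
  by_cases h : P (fillTable P b m t) t <;> simp [fillTable, h]

end fillTable

theorem exists_fillTable {e b : ℕ → ℕ} {P : ℕ → (ℕ → ℕ) → ℕ → Prop}
    (he : Comp vertexCtx fun a => e a.1) (hb : Comp vertexCtx fun a => b a.1)
    (hP : CompP vertexCtx.ext fun p => P p.1.1 p.1.2.1 p.2) :
    ∃ (p : Prog) (q : ℕ), ∀ (n : ℕ) (s : Store), s.reg 0 = n → (∀ y, s.mem y ≤ 1) →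
      Does p s ((n + 3) ^ q) fun s' => s'.mem = fillTable (P n) (b n) s.mem (e n) ∧
        s'.reg 0 = n ∧ s'.reg 1 = s.reg 1 := by
  classical
  obtain ⟨hbe, Te, hTe, hpe⟩ := he
  obtain ⟨-, Ta, ⟨qa, hTa⟩, hpa⟩ := hb.weaken.add Comp.top
  obtain ⟨-, Tv, ⟨qv, hTv⟩, hpv⟩ := hP
  have hTa' : PolyBdd vertexCtx.ext Ta := ⟨qa, hTa⟩
  have hTv' : PolyBdd vertexCtx.ext Tv := ⟨qv, hTv⟩
  obtain ⟨Ga, hGa, hGa'⟩ := hTa'.subst hbe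
  obtain ⟨Gv, hGv, hGv'⟩ := hTv'.subst hbe
  -- Working from register 2 upwards protects register 1, which holds k although it is not a
  -- variable of `vertexCtx`.
  obtain ⟨pe, hpe⟩ := hpe 2 id (fun x hx => by change x < 1 at hx; simp; omega)
  have hρ : ∀ x < vertexCtx.ext.m, Function.update id 1 3 x < 5 := fun x hx => by
    change x < 1 + 1 at hx
    simp only [Function.update_apply, id]
    split_ifs <;> omega
  obtain ⟨pa, hpa⟩ := hpa 5 (Function.update id 1 3) hρ
  obtain ⟨pv, hpv⟩ := hpv 6 (Function.update id 1 3) fun x hx => (hρ x hx).trans (by omega)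
  -- The memory changes from round to round, so the time per round needs a bound that depends on n
  -- only.
  obtain ⟨G, hG, hGa2, hGv2⟩ : ∃ G : ℕ × BitMem → ℕ, (∃ q, ∀ a, G a = (a.1 + 3) ^ q) ∧
      (∀ a, Ga a ≤ G a) ∧ ∀ a, Gv a ≤ G a := by
    obtain ⟨q, hq⟩ := hGa.add hGv
    refine ⟨fun a => (a.1 + 3) ^ q, ⟨q, fun _ => rfl⟩, fun a => ?_, fun a => ?_⟩
    · exact (Nat.le_add_right _ _).trans (hq a)
    · exact (Nat.le_add_left _ _).trans (hq a)
  obtain ⟨qG, hG⟩ := hG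
  have hGb : PolyBdd vertexCtx G := ⟨qG, fun a => (hG a).le⟩
  obtain ⟨q, hq⟩ := hTe.add ((PolyBdd.const 1).add ((PolyBdd.const 1).add
    ((hbe.mul ((hGb.add (hGb.add (PolyBdd.const 3))).add (PolyBdd.const 1))).add
      (PolyBdd.const 1))))
  -- Registers: 2 remaining rounds, 3 current round, 4 the constant 1, 5 the address, 6 the bit to
  -- be written.
  refine ⟨.seq pe (.seq (.instr (.const 3 0)) (.seq (.instr (.const 4 1)) (.loop 2 (.seq pa
    (.seq pv (.seq (.instr (.store 5 6)) (.seq (.instr (.add 3 3 4))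
      (.instr (.sub 2 2 4))))))))), q, fun n s hn hs => ?_⟩
  refine Does.mono (Does.seq ?_) (hq (n, ⟨s.mem, hs⟩)) fun _ h => h
  have hM : vertexCtx.Matches id (n, ⟨s.mem, hs⟩) s :=
    ⟨fun x hx => by change x < 1 at hx; obtain rfl : x = 0 := by omega
                    exact hn, rfl⟩
  refine (hpe _ s hM).mono le_rfl fun s₁ h₁ =>
    Does.seq (Does.instr (Does.seq (Does.instr ?_)))
  refine (Does.loop (fun r s' => r ≤ e n ∧ s'.mem = fillTable (P n) (b n) s.mem (e n - r) ∧
      s'.reg 0 = n ∧ s'.reg 1 = s.reg 1 ∧ s'.reg 2 = r ∧ s'.reg 3 = e n - r ∧ s'.reg 4 = 1)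
      (T := G (n, ⟨s.mem, hs⟩) + (G (n, ⟨s.mem, hs⟩) + 3)) (fun r s' h => h.2.2.2.2.1) ?_
      (e n) _ ?_).mono le_rfl ?_
  · rintro r s' ⟨hr, hmem, h0, h1, h2, h3, h4⟩
    have hs' : ∀ y, s'.mem y ≤ 1 := fun y => by rw [hmem]; exact fillTable_le hs _ _
    have hM' : vertexCtx.Matches id (n, ⟨s'.mem, hs'⟩) s' :=
      ⟨fun x hx => by change x < 1 at hx; obtain rfl : x = 0 := by omega
                      exact h0, rfl⟩
    have hM2 := hM'.ext h3
    have hle : e n - (r + 1) ≤ e n := Nat.sub_le _ _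
    refine Does.seq ((hpa _ s' hM2).mono ?_ fun s'' h'' => Does.seq ((hpv ((n, ⟨s'.mem, hs'⟩), e n - (r + 1)) s'' ?_).mono ?_
      fun s₃ h₃ => Does.seq (T := 1) (U := 1 + 1) (Does.instr (Does.seq (Does.instr
        (Does.instr ?_))))))
    · refine ((hGa' (n, ⟨s'.mem, hs'⟩) _ hle).trans (hGa2 _)).trans ?_
      rw [hG, hG]
    · exact hM2.of_same h''.2 hρ
    · refine ((hGv' (n, ⟨s'.mem, hs'⟩) _ hle).trans (hGv2 _)).trans ?_
      rw [hG, hG]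
    · have hlt : e n - (r + 1) + 1 = e n - r := by omega
      have e5 := (h₃.2.2 5 (by omega)).trans h''.1
      have ex : ∀ x < 5, s₃.reg x = s'.reg x := fun x hx =>
        (h₃.2.2 x (by omega)).trans (h''.2.2 x hx)
      have emem : s₃.mem = s'.mem := h₃.2.1.trans h''.2.1
      refine ⟨by omega, ?_, ?_, ?_, ?_, ?_, ?_⟩
      · simp only [Instr.exec]
        rw [e5, h₃.1, emem, ← hlt, fillTable, ← hmem]
      · simp [Instr.exec, ex, h0]
      · simp [Instr.exec, ex, h1]
      · simp [Instr.exec, ex, h2, h4]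
      · simp [Instr.exec, ex, h3, h4, hlt]
      · simp [Instr.exec, ex, h4]
  · refine ⟨le_rfl, ?_, ?_, ?_, ?_, ?_, ?_⟩
    · simp [Instr.exec, fillTable, h₁.2.1]
    · simp [Instr.exec, h₁.2.2, hn]
    · simp [Instr.exec, h₁.2.2]
    · simp [Instr.exec, h₁.1]
    · simp [Instr.exec]
    · simp [Instr.exec]
  · rintro s' ⟨-, hmem, h0, h1, -⟩
    exact ⟨hmem, h0, h1⟩

/-! ### The ingredients of the algorithm -/

/-- The memory represents an arc from `u` to `v`. -/
def MemAdj (n : ℕ) (m : ℕ → ℕ) (u v : ℕ) : Prop := m (u * n + v) ≠ 0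

/-- The vertex `v` belongs to the triple with number `t`. -/
def InTriple (n t v : ℕ) : Prop := v = t / n / n ∨ v = t / n % n ∨ v = t % n

/-- The vertex `v` belongs to a chosen triple with number less than `T`. -/
def Marked (n : ℕ) (m : ℕ → ℕ) (T v : ℕ) : Prop := ∃ t < T, m (n * n + t) ≠ 0 ∧ InTriple n t v

/-- The triple with number `t` is a triangle with at most one vertex in the triples chosen
earlier. -/
def Choosable (n : ℕ) (m : ℕ → ℕ) (t : ℕ) : Prop :=
  (MemAdj n m (t / n / n) (t / n % n) ∧ MemAdj n m (t / n % n) (t % n) ∧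
    MemAdj n m (t % n) (t / n / n)) ∧
  ¬ (Marked n m t (t / n / n) ∧ Marked n m t (t / n % n)) ∧
  ¬ (Marked n m t (t / n % n) ∧ Marked n m t (t % n)) ∧
  ¬ (Marked n m t (t / n / n) ∧ Marked n m t (t % n))

open Classical in
/-- The number of chosen triples. -/
noncomputable def chosenCount (n : ℕ) (m : ℕ → ℕ) : ℕ :=
  ((Finset.range (n * n * n)).filter fun t => m (n * n + t) ≠ 0).card

/-- The vertex `v` belongs to a chosen triple. -/
def InHub (n : ℕ) (m : ℕ → ℕ) (v : ℕ) : Prop := Marked n m (n * n * n) v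

open Classical in
/-- The number of out-neighbours in the hub. -/
noncomputable def hubDegree (n : ℕ) (m : ℕ → ℕ) (u : ℕ) : ℕ :=
  ((Finset.range n).filter fun v => InHub n m v ∧ MemAdj n m u v).card

open Classical in
/-- The number of in-neighbours outside the hub with the same number of out-neighbours in it. -/
noncomputable def hubRank (n : ℕ) (m : ℕ → ℕ) (u : ℕ) : ℕ :=
  ((Finset.range n).filter fun v =>
    (¬ InHub n m v ∧ hubDegree n m v = hubDegree n m u) ∧ MemAdj n m v u).card

/-- The vertices of the kernel. -/
def Kept (n : ℕ) (m : ℕ → ℕ) (M u : ℕ) : Prop := InHub n m u ∨ hubRank n m u < M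

open Classical in
/-- The number of vertices of the kernel below `u`. -/
noncomputable def keptCount (n : ℕ) (m : ℕ → ℕ) (M u : ℕ) : ℕ :=
  ((Finset.range u).filter fun v => Kept n m M v).card

open Classical in
/-- The vertex number `j` of the kernel. -/
noncomputable def keptNth (n : ℕ) (m : ℕ → ℕ) (M j : ℕ) : ℕ :=
  ∑ u ∈ Finset.range n, if Kept n m M u ∧ keptCount n m M u = j then u else 0

/-- The numbers `w i j`, where `i < k` and `j < r i`, describe `k` arc-disjoint cycles of length at
most `l`. -/
def Describes (n : ℕ) (m : ℕ → ℕ) (k l : ℕ) (r : ℕ → ℕ) (w : ℕ → ℕ → ℕ) : Prop :=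
  ∀ i < k, (0 < r i ∧ r i ≤ l) ∧ ∀ j < r i,
    (w i j < n ∧ MemAdj n m (w i j) (w i ((j + 1) % r i))) ∧
    (∀ j' < j, w i j ≠ w i j') ∧
    ∀ i' < i, ∀ j' < r i',
      ¬ (w i j = w i' j' ∧ w i ((j + 1) % r i) = w i' ((j' + 1) % r i'))

/-- The bound on the length of the cycles. -/
def cycleBound (k : ℕ) : ℕ := 2 * k + 3

/-- The bound on the number of vertices of the cycles. -/
def vertexBound (k : ℕ) : ℕ := k * cycleBound k

/-- The number of digits of a description of `k` cycles. -/
def digitCount (k : ℕ) : ℕ := k * (cycleBound k + 1)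

/-- The number of vertices of the kernel. -/
noncomputable def kernelSize (n : ℕ) (m : ℕ → ℕ) (k : ℕ) : ℕ := keptCount n m (vertexBound k) n

/-- The lengths of the cycles encoded by `c`. -/
noncomputable def codeLength (n : ℕ) (m : ℕ → ℕ) (k c i : ℕ) : ℕ :=
  digit (kernelSize n m k) c (i * (cycleBound k + 1)) + 1

/-- The vertices of the cycles encoded by `c`. -/
noncomputable def codeVertex (n : ℕ) (m : ℕ → ℕ) (k c i j : ℕ) : ℕ :=
  keptNth n m (vertexBound k) (digit (kernelSize n m k) c (i * (cycleBound k + 1) + (1 + j)))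

/-- Some number encodes `k` arc-disjoint cycles. -/
def HasCode (n : ℕ) (m : ℕ → ℕ) (k : ℕ) : Prop :=
  ∃ c < kernelSize n m k ^ digitCount k,
    Describes n m k (cycleBound k) (codeLength n m k c) (codeVertex n m k c)

/-! ### Computability of the ingredients -/

section Comp

variable {α : Type} {Γ : Ctx α} {N M K T U W X : α → ℕ}

theorem CompP.memAdj (hN : Comp Γ N) (hU : Comp Γ U) (hW : Comp Γ W) :
    CompP Γ fun a => MemAdj (N a) (Γ.mem a) (U a) (W a) :=
  (CompP.eq (((hU.mul hN).add hW).load) (Comp.const 0)).not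

theorem CompP.inTriple (hN : Comp Γ N) (hT : Comp Γ T) (hW : Comp Γ W) :
    CompP Γ fun a => InTriple (N a) (T a) (W a) :=
  (CompP.eq hW ((hT.div hN).div hN)).or
    ((CompP.eq hW ((hT.div hN).mod hN)).or (CompP.eq hW (hT.mod hN)))

theorem CompP.marked (hN : Comp Γ N) (hT : Comp Γ T) (hW : Comp Γ W) :
    CompP Γ fun a => Marked (N a) (Γ.mem a) (T a) (W a) := by
  refine CompP.exists_lt (P := fun a i => Γ.mem a (N a * N a + i) ≠ 0 ∧ InTriple (N a) i (W a)) hT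
    (CompP.and ?_ (CompP.inTriple hN.weaken Comp.top hW.weaken))
  exact (CompP.eq (Comp.load (Γ := Γ.ext) ((hN.weaken.mul hN.weaken).add Comp.top))
    (Comp.const 0)).not

theorem CompP.choosable (hN : Comp Γ N) (hT : Comp Γ T) :
    CompP Γ fun a => Choosable (N a) (Γ.mem a) (T a) := by
  have ha := (hT.div hN).div hN
  have hb := (hT.div hN).mod hN
  have hc := hT.mod hN
  have ma := CompP.marked hN hT ha
  have mb := CompP.marked hN hT hb
  have mc := CompP.marked hN hT hc
  exact ((CompP.memAdj hN ha hb).and ((CompP.memAdj hN hb hc).and (CompP.memAdj hN hc ha))).and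
    ((ma.and mb).not.and ((mb.and mc).not.and (ma.and mc).not))

theorem Comp.chosenCount (hN : Comp Γ N) : Comp Γ fun a => chosenCount (N a) (Γ.mem a) :=
  Comp.count (P := fun a t => Γ.mem a (N a * N a + t) ≠ 0) ((hN.mul hN).mul hN)
    (CompP.eq (Comp.load (Γ := Γ.ext) ((hN.weaken.mul hN.weaken).add Comp.top)) (Comp.const 0)).not

theorem CompP.inHub (hN : Comp Γ N) (hU : Comp Γ U) :
    CompP Γ fun a => InHub (N a) (Γ.mem a) (U a) :=
  CompP.marked hN ((hN.mul hN).mul hN) hU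

open Classical in
theorem Comp.hubDegree (hN : Comp Γ N) (hU : Comp Γ U) :
    Comp Γ fun a => hubDegree (N a) (Γ.mem a) (U a) :=
  Comp.count (P := fun a v => InHub (N a) (Γ.mem a) v ∧ MemAdj (N a) (Γ.mem a) (U a) v) hN
    ((CompP.inHub (Γ := Γ.ext) hN.weaken Comp.top).and
      (CompP.memAdj (Γ := Γ.ext) hN.weaken hU.weaken Comp.top))

open Classical in
theorem Comp.hubRank (hN : Comp Γ N) (hU : Comp Γ U) :
    Comp Γ fun a => hubRank (N a) (Γ.mem a) (U a) :=
  Comp.count (P := fun a v => (¬ InHub (N a) (Γ.mem a) v ∧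
      ArcPacking.hubDegree (N a) (Γ.mem a) v = ArcPacking.hubDegree (N a) (Γ.mem a) (U a)) ∧
      MemAdj (N a) (Γ.mem a) v (U a)) hN
    (((CompP.inHub (Γ := Γ.ext) hN.weaken Comp.top).not.and
      (CompP.eq (Comp.hubDegree (Γ := Γ.ext) hN.weaken Comp.top) (Comp.hubDegree hN hU).weaken)).and
      (CompP.memAdj (Γ := Γ.ext) hN.weaken Comp.top hU.weaken))

theorem CompP.kept (hN : Comp Γ N) (hM : Comp Γ M) (hU : Comp Γ U) :
    CompP Γ fun a => Kept (N a) (Γ.mem a) (M a) (U a) :=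
  (CompP.inHub hN hU).or (CompP.lt (Comp.hubRank hN hU) hM)

open Classical in
theorem Comp.keptCount (hN : Comp Γ N) (hM : Comp Γ M) (hU : Comp Γ U) :
    Comp Γ fun a => keptCount (N a) (Γ.mem a) (M a) (U a) :=
  Comp.count (P := fun a v => Kept (N a) (Γ.mem a) (M a) v) hU
    (CompP.kept (Γ := Γ.ext) hN.weaken hM.weaken Comp.top)

theorem Comp.keptNth (hN : Comp Γ N) (hM : Comp Γ M) (hU : Comp Γ U) :
    Comp Γ fun a => keptNth (N a) (Γ.mem a) (M a) (U a) := by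
  classical
  exact Comp.sum (b := fun a u => if Kept (N a) (Γ.mem a) (M a) u ∧
    ArcPacking.keptCount (N a) (Γ.mem a) (M a) u = U a then u else 0) hN
    (Comp.ite ((CompP.kept (Γ := Γ.ext) hN.weaken hM.weaken Comp.top).and
      (CompP.eq (Comp.keptCount (Γ := Γ.ext) hN.weaken hM.weaken Comp.top) hU.weaken)) Comp.top
      (Comp.const 0))

theorem Comp.cycleBound (hK : Comp Γ K) : Comp Γ fun a => cycleBound (K a) :=
  ((Comp.const 2).mul hK).add (Comp.const 3)

theorem Comp.vertexBound (hK : Comp Γ K) : Comp Γ fun a => vertexBound (K a) :=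
  hK.mul hK.cycleBound

theorem Comp.digitCount (hK : Comp Γ K) : Comp Γ fun a => digitCount (K a) :=
  hK.mul (hK.cycleBound.add (Comp.const 1))

theorem Comp.kernelSize (hN : Comp Γ N) (hK : Comp Γ K) :
    Comp Γ fun a => kernelSize (N a) (Γ.mem a) (K a) :=
  Comp.keptCount hN hK.vertexBound hN

theorem Comp.codeLength (hN : Comp Γ N) (hK : Comp Γ K) (hU : Comp Γ U) (hW : Comp Γ W) :
    Comp Γ fun a => codeLength (N a) (Γ.mem a) (K a) (U a) (W a) :=
  (Comp.digit (Comp.kernelSize hN hK) hU (hW.mul (hK.cycleBound.add (Comp.const 1)))).add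
    (Comp.const 1)

theorem Comp.codeVertex (hN : Comp Γ N) (hK : Comp Γ K) (hU : Comp Γ U) (hW : Comp Γ W)
    (hX : Comp Γ X) : Comp Γ fun a => codeVertex (N a) (Γ.mem a) (K a) (U a) (W a) (X a) :=
  Comp.keptNth hN hK.vertexBound (Comp.digit (Comp.kernelSize hN hK) hU
    ((hW.mul (hK.cycleBound.add (Comp.const 1))).add ((Comp.const 1).add hX)))

/-- All the bounded quantifiers become loops. Only the search over the codes is long, and `h`
requires the context to count it in its size. -/
theorem CompP.hasCode (hN : Comp Γ N) (hK : Comp Γ K)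
    (h : PolyBdd Γ fun a => kernelSize (N a) (Γ.mem a) (K a) ^ digitCount (K a)) :
    CompP Γ fun a => HasCode (N a) (Γ.mem a) (K a) := by
  refine CompP.exists_lt (P := fun a c => Describes (N a) (Γ.mem a) (K a) (cycleBound (K a))
    (ArcPacking.codeLength (N a) (Γ.mem a) (K a) c)
    (ArcPacking.codeVertex (N a) (Γ.mem a) (K a) c))
    (Comp.pow (Comp.kernelSize hN hK) hK.digitCount h) ?_
  have hN₁ := hN.weaken
  have hK₁ := hK.weaken
  refine CompP.forall_lt (Γ := Γ.ext) hK₁ ?_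
  have hN₂ := hN₁.weaken
  have hK₂ := hK₁.weaken
  have hc₂ := (Comp.top (Γ := Γ)).weaken
  have hi₂ := Comp.top (Γ := Γ.ext)
  have hr₂ := Comp.codeLength (Γ := Γ.ext.ext) hN₂ hK₂ hc₂ hi₂
  refine ((CompP.lt (Comp.const 0) hr₂).and (CompP.le hr₂ hK₂.cycleBound)).and
    (CompP.forall_lt (Γ := Γ.ext.ext) hr₂ ?_)
  have hN₃ := hN₂.weaken
  have hK₃ := hK₂.weaken
  have hc₃ := hc₂.weaken
  have hi₃ := hi₂.weaken
  have hr₃ := hr₂.weaken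
  have hj₃ := Comp.top (Γ := Γ.ext.ext)
  have hw₃ := Comp.codeVertex (Γ := Γ.ext.ext.ext) hN₃ hK₃ hc₃ hi₃ hj₃
  have hw₃' := Comp.codeVertex (Γ := Γ.ext.ext.ext) hN₃ hK₃ hc₃ hi₃
    (Comp.mod (hj₃.add (Comp.const 1)) hr₃)
  refine ((CompP.lt hw₃ hN₃).and (CompP.memAdj (Γ := Γ.ext.ext.ext) hN₃ hw₃ hw₃')).and
    (CompP.and (CompP.forall_lt (Γ := Γ.ext.ext.ext) hj₃ (CompP.eq hw₃.weaken
      (Comp.codeVertex (Γ := Γ.ext.ext.ext.ext) hN₃.weaken hK₃.weaken hc₃.weaken hi₃.weaken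
        Comp.top)).not) (CompP.forall_lt (Γ := Γ.ext.ext.ext) hi₃ ?_))
  have hr₄ := Comp.codeLength (Γ := Γ.ext.ext.ext.ext) hN₃.weaken hK₃.weaken hc₃.weaken Comp.top
  refine CompP.forall_lt (Γ := Γ.ext.ext.ext.ext) hr₄ (CompP.and (CompP.eq hw₃.weaken.weaken ?_)
    (CompP.eq hw₃'.weaken.weaken ?_)).not
  · exact Comp.codeVertex (Γ := Γ.ext.ext.ext.ext.ext) hN₃.weaken.weaken hK₃.weaken.weaken
      hc₃.weaken.weaken (Comp.weaken Comp.top) Comp.top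
  · exact Comp.codeVertex (Γ := Γ.ext.ext.ext.ext.ext) hN₃.weaken.weaken hK₃.weaken.weaken
      hc₃.weaken.weaken (Comp.weaken Comp.top) (Comp.mod (Comp.top.add (Comp.const 1)) hr₄.weaken)

end Comp

/-! ### Packings of short cycles -/

section Short

variable {V : Type*} {D : Digraph V}

theorem cycleArcs_cons (v : V) (l : List V) : cycleArcs (v :: l) = (v :: l).zip (l ++ [v]) := by
  simp [cycleArcs]

/-- The cycle falls into a path from v to x and a path back; a chord between v and x closes one of
them to a cycle. -/
theorem cycleArcs_split (v x : V) (p q : List V) : cycleArcs (v :: (p ++ x :: q)) =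
    (v :: p).zip (p ++ [x]) ++ (x :: q).zip (q ++ [v]) := by
  rw [cycleArcs_cons, ← List.zip_append (by simp)]
  simp

theorem cycleArcs_shortcut_out (v x : V) (q : List V) : cycleArcs (v :: x :: q) =
    (v, x) :: (x :: q).zip (q ++ [v]) := by
  simp [cycleArcs_cons]

theorem cycleArcs_shortcut_in (v x : V) (p : List V) : cycleArcs (v :: (p ++ [x])) =
    (v :: p).zip (p ++ [x]) ++ [(x, v)] := by
  simpa using cycleArcs_split v x p []

theorem IsTournament.adj_or (hD : IsTournament D) {u v : V} (h : u ≠ v) :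
    D.Adj u v ∨ D.Adj v u :=
  (hD.2 u v h).imp And.left And.left

theorem IsTournament.asymm (hD : IsTournament D) {u v : V} (h : D.Adj u v) : ¬ D.Adj v u := by
  intro h'
  have huv : u ≠ v := fun e => hD.1 v (e ▸ h)
  rcases hD.2 u v huv with h1 | h1
  · exact h1.2 h'
  · exact h1.2 h

theorem IsTournament.ne (hD : IsTournament D) {u v : V} (h : D.Adj u v) : u ≠ v :=
  fun e => hD.1 v (e ▸ h)

/-- A vertex of a cycle has at most one outgoing arc in it. -/
theorem cycleArcs_out_unique {c : List V} (hc : c.Nodup) {x y z : V} (hy : (x, y) ∈ cycleArcs c)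
    (hz : (x, z) ∈ cycleArcs c) : y = z := by
  obtain ⟨i, hi, hi'⟩ := List.mem_iff_getElem.1 hy
  obtain ⟨j, hj, hj'⟩ := List.mem_iff_getElem.1 hz
  simp only [cycleArcs, List.getElem_zip, Prod.mk.injEq] at hi' hj'
  have : i = j := (List.Nodup.getElem_inj_iff hc).1 (hi'.1.trans hj'.1.symm)
  subst this
  exact hi'.2.symm.trans hj'.2

/-- A vertex of a cycle has at most one incoming arc in it. -/
theorem cycleArcs_in_unique {c : List V} (hc : c.Nodup) {x y z : V} (hy : (y, x) ∈ cycleArcs c)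
    (hz : (z, x) ∈ cycleArcs c) : y = z := by
  obtain ⟨i, hi, hi'⟩ := List.mem_iff_getElem.1 hy
  obtain ⟨j, hj, hj'⟩ := List.mem_iff_getElem.1 hz
  simp only [cycleArcs, List.getElem_zip, Prod.mk.injEq] at hi' hj'
  have : i = j := (List.Nodup.getElem_inj_iff (List.nodup_rotate.2 hc)).1 (hi'.2.trans hj'.2.symm)
  subst this
  exact hi'.1.symm.trans hj'.1

/-- A family of `k` arc-disjoint cycles. -/
def IsPacking (D : Digraph V) {k : ℕ} (C : Fin k → List V) : Prop :=
  (∀ i, IsCycle D (C i)) ∧ ∀ i j, i ≠ j → List.Disjoint (cycleArcs (C i)) (cycleArcs (C j))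

theorem IsPacking.update {k : ℕ} {C : Fin k → List V} (h : IsPacking D C) (i : Fin k) {c : List V}
    (hc : IsCycle D c)
    (hd : ∀ j, j ≠ i → List.Disjoint (cycleArcs c) (cycleArcs (C j))) :
    IsPacking D (Function.update C i c) := by
  refine ⟨fun j => ?_, fun j j' hjj' => ?_⟩
  · by_cases hj : j = i
    · subst hj; simpa using hc
    · simpa [Function.update_of_ne hj] using h.1 j
  · by_cases hj : j = i
    · subst hj
      simpa [Function.update_of_ne hjj'.symm] using hd j' hjj'.symm
    · by_cases hj' : j' = i
      · subst hj'
        simpa [Function.update_of_ne hj] using (hd j hj).symm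
      · simpa [Function.update_of_ne hj, Function.update_of_ne hj'] using h.2 j j' hjj'

/-- In a packing with minimum total length, every chord at the first vertex of a cycle is used by
another cycle. -/
theorem IsPacking.chord_mem (hD : IsTournament D) {k : ℕ} {C : Fin k → List V}
    (h : IsPacking D C)
    (hmin : ∀ C' : Fin k → List V, IsPacking D C' → ∑ i, (C i).length ≤ ∑ i, (C' i).length)
    {i : Fin k} {v x : V} {p q : List V} (hi : C i = v :: (p ++ x :: q)) (hp : p ≠ [])
    (hq : q ≠ []) :
    ∃ j, (v, x) ∈ cycleArcs (C j) ∨ (x, v) ∈ cycleArcs (C j) := by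
  by_contra! hno
  -- A shorter cycle made of arcs of `C i` and the unused chord could replace `C i`, against
  -- minimality.
  have hshort : ∀ c, IsCycle D c →
      (∀ e ∈ cycleArcs c, e ∈ cycleArcs (C i) ∨ e = (v, x) ∨ e = (x, v)) →
      ¬ c.length < (C i).length := by
    intro c hc hsub hlt
    have hpk := h.update i hc fun j hj e he he' => by
      rcases hsub e he with h1 | h1 | h1
      · exact h.2 i j hj.symm h1 he'
      · exact (hno j).1 (h1 ▸ he')
      · exact (hno j).2 (h1 ▸ he')
    refine absurd (hmin _ hpk) (not_le.2 (Finset.sum_lt_sum (fun j _ => ?_)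
      ⟨i, Finset.mem_univ _, by simpa using hlt⟩))
    by_cases hj : j = i
    · subst hj; simpa using hlt.le
    · simp [Function.update_of_ne hj]
  obtain ⟨-, hnd, harc⟩ := h.1 i
  rw [hi] at hnd
  have hvx : v ≠ x := by
    rintro rfl
    simp at hnd
  have hp' := List.length_pos_iff.2 hp
  have hq' := List.length_pos_iff.2 hq
  rw [hi, cycleArcs_split] at harc
  have hsplit := cycleArcs_split v x p q
  -- A chord from v to x bypasses `p`, one from x to v cuts off `q`; both are nonempty, so either
  -- cycle is strictly shorter.
  rcases hD.adj_or hvx with hadj | hadj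
  · refine hshort (v :: x :: q) ⟨by simp, hnd.sublist ?_, fun e he => ?_⟩ (fun e he => ?_) ?_
    · exact List.Sublist.cons_cons _ (List.sublist_append_right _ _)
    · rw [cycleArcs_shortcut_out, List.mem_cons] at he
      rcases he with rfl | he
      · exact hadj
      · exact harc e (List.mem_append_right _ he)
    · rw [cycleArcs_shortcut_out, List.mem_cons] at he
      rcases he with rfl | he
      · exact .inr (.inl rfl)
      · exact .inl (by rw [hi, hsplit]; exact List.mem_append_right _ he)
    · simp [hi]; omega
  · refine hshort (v :: (p ++ [x])) ⟨by simp, hnd.sublist ?_, fun e he => ?_⟩ (fun e he => ?_) ?_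
    · exact List.Sublist.cons_cons _ (List.Sublist.append_left (by simp) _)
    · rw [cycleArcs_shortcut_in, List.mem_append, List.mem_singleton] at he
      rcases he with he | rfl
      · exact harc e (List.mem_append_left _ he)
      · exact hadj
    · rw [cycleArcs_shortcut_in, List.mem_append, List.mem_singleton] at he
      rcases he with he | rfl
      · exact .inl (by rw [hi, hsplit]; exact List.mem_append_left _ he)
      · exact .inr (.inr rfl)
    · simp [hi]; omega

/-- If a tournament has `k` arc-disjoint cycles, then it has `k` such cycles of length at most
`2 * k + 3`. -/
theorem exists_short_packing (hD : IsTournament D) {k : ℕ} (h : HasArcDisjointCycles D k) :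
    ∃ C : Fin k → List V, IsPacking D C ∧ ∀ i, (C i).length ≤ 2 * k + 3 := by
  classical
  have hex : ∃ s, ∃ C : Fin k → List V, IsPacking D C ∧ ∑ i, (C i).length = s := by
    obtain ⟨C, hC⟩ := h
    exact ⟨_, C, hC, rfl⟩
  obtain ⟨C, hC, hsum⟩ := Nat.find_spec hex
  have hmin : ∀ C' : Fin k → List V, IsPacking D C' →
      ∑ i, (C i).length ≤ ∑ i, (C' i).length := fun C' hC' =>
    hsum ▸ Nat.find_min' hex ⟨C', hC', rfl⟩
  refine ⟨C, hC, fun i => ?_⟩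
  by_contra! hlen
  obtain ⟨v, r, hvr⟩ : ∃ v r, C i = v :: r := List.exists_cons_of_ne_nil (hC.1 i).1
  have hr : 2 * k + 3 ≤ r.length := by
    rw [hvr, List.length_cons] at hlen; omega
  have hnd : r.Nodup := by
    have := (hC.1 i).2.1
    rw [hvr] at this
    exact (List.nodup_cons.1 this).2
  -- The positions 1, …, 2k+1 of `r` leave vertices on both sides. Each chord is assigned the cycle
  -- that uses it and its direction at v.
  have hchord : ∀ j : Fin (2 * k + 1), ∃ z : Fin k × Bool,
      if z.2 then (v, r[j.1 + 1]'(by omega)) ∈ cycleArcs (C z.1)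
      else (r[j.1 + 1]'(by omega), v) ∈ cycleArcs (C z.1) := by
    intro j
    obtain ⟨i', hi'⟩ := hC.chord_mem hD hmin (i := i) (v := v) (x := r[j.1 + 1]'(by omega))
      (p := r.take (j.1 + 1)) (q := r.drop (j.1 + 2)) (by
        rw [hvr, List.cons_inj_right, List.cons_getElem_drop_succ, List.take_append_drop])
      (by rw [← List.length_pos_iff, List.length_take]; omega)
      (by rw [← List.length_pos_iff, List.length_drop]; omega)
    rcases hi' with hi' | hi'
    · exact ⟨(i', true), by simpa using hi'⟩
    · exact ⟨(i', false), by simpa using hi'⟩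
  choose z hz using hchord
  -- There are 2k pairs of a cycle and a direction for 2k+1 chords, but a cycle has only one
  -- outgoing and one incoming arc at v.
  obtain ⟨a, b, hab, hzab⟩ := Fintype.exists_ne_map_eq_of_card_lt z (by simp; omega)
  refine hab (Fin.ext ?_)
  have ha := hz a
  have hb := hz b
  rw [← hzab] at hb
  have hget : r[a.1 + 1]'(by omega) = r[b.1 + 1]'(by omega) := by
    by_cases hbool : (z a).2 = true
    · rw [if_pos hbool] at ha hb
      exact cycleArcs_out_unique (hC.1 _).2.1 ha hb
    · rw [if_neg hbool] at ha hb
      exact cycleArcs_in_unique (hC.1 _).2.1 ha hb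
  have := (List.Nodup.getElem_inj_iff hnd).1 hget
  omega

theorem cycleArcs_map {W : Type*} (φ : V → W) (c : List V) :
    cycleArcs (c.map φ) = (cycleArcs c).map (Prod.map φ φ) := by
  rw [cycleArcs, cycleArcs, ← List.map_rotate, List.zip_map]

theorem mem_of_mem_cycleArcs {c : List V} {e : V × V} (he : e ∈ cycleArcs c) :
    e.1 ∈ c ∧ e.2 ∈ c := by
  obtain ⟨h1, h2⟩ := List.of_mem_zip (show (e.1, e.2) ∈ c.zip (c.rotate 1) from he)
  exact ⟨h1, List.mem_rotate.1 h2⟩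

end Short

/-! ### The kernel -/

section Kernel

variable {V : Type*} {D : Digraph V} {S : Finset V}

/-- Every triangle has two vertices in `S`. -/
def IsHub (D : Digraph V) (S : Finset V) : Prop :=
  ∀ a b c, D.Adj a b → D.Adj b c → D.Adj c a →
    (a ∈ S ∧ b ∈ S) ∨ (b ∈ S ∧ c ∈ S) ∨ (a ∈ S ∧ c ∈ S)

open Classical in
/-- The number of out-neighbours in `S`. -/
noncomputable def outDegreeTo (D : Digraph V) (S : Finset V) (u : V) : ℕ :=
  (S.filter fun v => D.Adj u v).card

/-- An arc from w to u would close a triangle with two vertices outside S. The vertex w is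
arbitrary, which gives both transitivity outside S and nested neighbourhoods in S. -/
theorem IsHub.trans_of_not_mem (hS : IsHub D S) (hD : IsTournament D) {u v w : V} (hu : u ∉ S)
    (hv : v ∉ S) (huv : D.Adj u v) (hvw : D.Adj v w) : D.Adj u w := by
  have huw : u ≠ w := by rintro rfl; exact hD.asymm huv hvw
  refine (hD.adj_or huw).resolve_right fun hwu => ?_
  rcases hS u v w huv hvw hwu with h | h | h
  · exact hu h.1
  · exact hv h.1
  · exact hu h.1

theorem IsHub.outDegreeTo_le (hS : IsHub D S) (hD : IsTournament D) {u v : V} (hu : u ∉ S)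
    (hv : v ∉ S) (huv : D.Adj u v) : outDegreeTo D S v ≤ outDegreeTo D S u := by
  classical
  refine Finset.card_le_card fun s hs => ?_
  rw [Finset.mem_filter] at hs ⊢
  exact ⟨hs.1, hS.trans_of_not_mem hD hu hv huv hs.2⟩

/-- Nested finite sets of equal size coincide, so vertices of one class are twins with respect to S.
-/
theorem IsHub.adj_iff_of_outDegreeTo_eq (hS : IsHub D S) (hD : IsTournament D) {u v s : V}
    (hu : u ∉ S) (hv : v ∉ S) (h : outDegreeTo D S u = outDegreeTo D S v) (hs : s ∈ S) :
    D.Adj u s ↔ D.Adj v s := by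
  classical
  wlog huv : D.Adj u v generalizing u v
  · by_cases huv' : u = v
    · rw [huv']
    · exact (this hv hu h.symm ((hD.adj_or huv').resolve_left huv)).symm
  have hsub : S.filter (fun s => D.Adj v s) ⊆ S.filter fun s => D.Adj u s := fun s hs => by
    rw [Finset.mem_filter] at hs ⊢
    exact ⟨hs.1, hS.trans_of_not_mem hD hu hv huv hs.2⟩
  have := Finset.eq_of_subset_of_card_le hsub h.le
  simpa [hs] using (Finset.ext_iff.1 this s).symm

variable [Fintype V]

open Classical in
/-- The in-neighbours of `u` outside `S` that have the same number of out-neighbours in `S`. -/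
noncomputable def classBelow (D : Digraph V) (S : Finset V) (u : V) : Finset V :=
  Finset.univ.filter fun v =>
    (v ∉ S ∧ outDegreeTo D S v = outDegreeTo D S u) ∧ D.Adj v u

/-- By transitivity everything below u is below v, and so is u itself. The size of `classBelow` is
therefore the rank in the linear order of a class. -/
theorem IsHub.classBelow_card_lt (hS : IsHub D S) (hD : IsTournament D) {u v : V} (hu : u ∉ S)
    (h : outDegreeTo D S u = outDegreeTo D S v) (huv : D.Adj u v) :
    (classBelow D S u).card < (classBelow D S v).card := by
  classical
  refine Finset.card_lt_card ((Finset.ssubset_iff_of_subset fun w hw => ?_).2 ⟨u, ?_, ?_⟩)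
  · simp only [classBelow, Finset.mem_filter, Finset.mem_univ, true_and] at hw ⊢
    exact ⟨⟨hw.1.1, hw.1.2.trans h⟩, hS.trans_of_not_mem hD hw.1.1 hu hw.2 huv⟩
  · simp [classBelow, hu, h, huv]
  · simp [classBelow, hD.1]

theorem IsHub.eq_of_classBelow_card_eq (hS : IsHub D S) (hD : IsTournament D) {u v : V}
    (hu : u ∉ S) (hv : v ∉ S) (h : outDegreeTo D S u = outDegreeTo D S v)
    (hc : (classBelow D S u).card = (classBelow D S v).card) : u = v := by
  by_contra huv
  rcases hD.adj_or huv with h' | h'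
  · exact (hS.classBelow_card_lt hD hu h h').ne hc
  · exact (hS.classBelow_card_lt hD hv h.symm h').ne hc.symm

open Classical in
/-- Every number less than the size of a class is the rank of one of its members. -/
theorem IsHub.exists_classBelow_card_eq (hS : IsHub D S) (hD : IsTournament D) {u : V} (hu : u ∉ S)
    {r : ℕ} (hr : r ≤ (classBelow D S u).card) :
    ∃ w, w ∉ S ∧ outDegreeTo D S w = outDegreeTo D S u ∧ (classBelow D S w).card = r := by
  set Q := Finset.univ.filter fun v => v ∉ S ∧ outDegreeTo D S v = outDegreeTo D S u with hQ
  have hlt : ∀ v ∈ Q, (classBelow D S v).card < Q.card := fun v hv => by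
    simp only [hQ, Finset.mem_filter, Finset.mem_univ, true_and] at hv
    refine Finset.card_lt_card ((Finset.ssubset_iff_of_subset fun w hw => ?_).2 ⟨v, ?_, ?_⟩)
    · simp only [classBelow, hQ, Finset.mem_filter, Finset.mem_univ, true_and] at hw ⊢
      exact ⟨hw.1.1, hw.1.2.trans hv.2⟩
    · simpa [hQ] using hv
    · simp [classBelow, hD.1]
  -- Ranks are injective on the class and less than its size, so they exhaust the range.
  have himg : Q.image (fun v => (classBelow D S v).card) = Finset.range Q.card := by
    refine Finset.eq_of_subset_of_card_le (fun x hx => ?_) ?_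
    · obtain ⟨v, hv, rfl⟩ := Finset.mem_image.1 hx
      exact Finset.mem_range.2 (hlt v hv)
    · rw [Finset.card_range, Finset.card_image_of_injOn]
      intro v hv w hw hvw
      simp only [hQ, Finset.coe_filter, Finset.mem_univ, true_and, Set.mem_ofPred_eq] at hv hw
      exact hS.eq_of_classBelow_card_eq hD hv.1 hw.1 (hv.2.trans hw.2.symm) hvw
  have hmem : r ∈ Q.image fun v => (classBelow D S v).card := by
    rw [himg, Finset.mem_range]
    exact hr.trans_lt (hlt u (by simp [hQ, hu]))
  obtain ⟨w, hw, rfl⟩ := Finset.mem_image.1 hmem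
  simp only [hQ, Finset.mem_filter, Finset.mem_univ, true_and] at hw
  exact ⟨w, hw.1, hw.2, rfl⟩

/-- A set of at most `M` vertices can be mapped into the kernel such that arcs are preserved. -/
theorem IsHub.exists_map (hS : IsHub D S) (hD : IsTournament D) {M : ℕ} (U : Finset V)
    (hU : U.card ≤ M) :
    ∃ φ : V → V, (∀ u ∈ U, φ u ∈ S ∨ (classBelow D S (φ u)).card < M) ∧
      ∀ u ∈ U, ∀ v ∈ U, D.Adj u v → D.Adj (φ u) (φ v) := by
  classical
  -- Hub vertices stay fixed. Any other vertex slides down its class to the rank it has among the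
  -- members of `U`.
  have hex : ∀ u, ∃ w, (u ∈ S → w = u) ∧ (u ∉ S → w ∉ S ∧
      outDegreeTo D S w = outDegreeTo D S u ∧
      (classBelow D S w).card = (U ∩ classBelow D S u).card) := by
    intro u
    by_cases hu : u ∈ S
    · exact ⟨u, fun _ => rfl, fun h => absurd hu h⟩
    · obtain ⟨w, hw⟩ := hS.exists_classBelow_card_eq hD hu
        (Finset.card_le_card (Finset.inter_subset_right (s₁ := U)))
      exact ⟨w, fun h => absurd h hu, fun _ => hw⟩
  choose φ hφS hφ using hex
  refine ⟨φ, fun u hu => ?_, fun u hu v hv huv => ?_⟩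
  · by_cases huS : u ∈ S
    · exact .inl (by rwa [hφS u huS])
    · refine .inr ?_
      rw [(hφ u huS).2.2]
      -- The inequality is strict because u belongs to `U` but is not below itself.
      refine lt_of_lt_of_le (Finset.card_lt_card
        ((Finset.ssubset_iff_of_subset Finset.inter_subset_left).2 ⟨u, hu, ?_⟩)) hU
      simp [classBelow, hD.1]
  · have huv' := hD.ne huv
    by_cases huS : u ∈ S <;> by_cases hvS : v ∈ S
    · rwa [hφS u huS, hφS v hvS]
    · obtain ⟨h1, h2, -⟩ := hφ v hvS
      rw [hφS u huS]
      refine (hD.adj_or fun h => h1 (by rwa [← h])).resolve_right fun h => ?_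
      exact hD.asymm huv ((hS.adj_iff_of_outDegreeTo_eq hD h1 hvS h2 huS).1 h)
    · obtain ⟨h1, h2, -⟩ := hφ u huS
      rw [hφS v hvS]
      exact (hS.adj_iff_of_outDegreeTo_eq hD h1 huS h2 hvS).2 huv
    · obtain ⟨h1, h2, h3⟩ := hφ u huS
      obtain ⟨g1, g2, g3⟩ := hφ v hvS
      -- Within a class the order of the ranks inside `U` is kept. Between classes, arcs run from
      -- the larger out-degree into S to the smaller.
      by_cases hcls : outDegreeTo D S u = outDegreeTo D S v
      · have hlt : (U ∩ classBelow D S u).card < (U ∩ classBelow D S v).card := by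
          refine Finset.card_lt_card ((Finset.ssubset_iff_of_subset fun w hw => ?_).2 ⟨u, ?_, ?_⟩)
          · simp only [classBelow, Finset.mem_inter, Finset.mem_filter, Finset.mem_univ,
              true_and] at hw ⊢
            exact ⟨hw.1, ⟨hw.2.1.1, hw.2.1.2.trans hcls⟩,
              hS.trans_of_not_mem hD hw.2.1.1 huS hw.2.2 huv⟩
          · simp [classBelow, huS, hcls, huv, hu]
          · simp [classBelow, hD.1]
        rw [← h3, ← g3] at hlt
        refine (hD.adj_or fun h => ?_).resolve_right fun h => ?_
        · rw [h] at hlt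
          exact lt_irrefl _ hlt
        · exact lt_asymm hlt (hS.classBelow_card_lt hD g1 (g2.trans (hcls.symm.trans h2.symm)) h)
      · have hlt := lt_of_le_of_ne (hS.outDegreeTo_le hD huS hvS huv) (Ne.symm hcls)
        rw [← h2, ← g2] at hlt
        refine (hD.adj_or fun h => ?_).resolve_right fun h => ?_
        · rw [h] at hlt
          exact lt_irrefl _ hlt
        · exact not_le.2 hlt (hS.outDegreeTo_le hD g1 h1 h)

-- A vertex outside S is determined by its out-degree into S, with |S| + 1 possible values, and its
-- rank.
open Classical in
theorem IsHub.card_kernel_le (hS : IsHub D S) (hD : IsTournament D) (M : ℕ) :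
    (Finset.univ.filter fun u => u ∈ S ∨ (classBelow D S u).card < M).card ≤
      S.card + (S.card + 1) * M := by
  have hsub : (Finset.univ.filter fun u => u ∈ S ∨ (classBelow D S u).card < M) ⊆
      S ∪ Finset.univ.filter fun u => u ∉ S ∧ (classBelow D S u).card < M := fun u hu => by
    simp only [Finset.mem_union, Finset.mem_filter, Finset.mem_univ, true_and] at hu ⊢
    tauto
  refine (Finset.card_le_card hsub).trans ((Finset.card_union_le _ _).trans
    (Nat.add_le_add_left ?_ _))
  rw [← Finset.card_range (S.card + 1), ← Finset.card_range M, ← Finset.card_product,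
    Finset.card_range]
  refine Finset.card_le_card_of_injOn
    (fun u => (outDegreeTo D S u, (classBelow D S u).card)) (fun u hu => ?_) fun u hu v hv huv => ?_
  · simp only [Finset.coe_filter, Finset.mem_univ, true_and, Set.mem_ofPred_eq] at hu
    simp only [Finset.coe_product, Set.mem_prod, Finset.coe_range, Set.mem_Iio]
    exact ⟨Nat.lt_succ_of_le (Finset.card_le_card (Finset.filter_subset _ _)), hu.2⟩
  · simp only [Finset.coe_filter, Finset.mem_univ, true_and, Set.mem_ofPred_eq] at hu hv
    rw [Prod.mk.injEq] at huv
    exact hS.eq_of_classBelow_card_eq hD hu.1 hv.1 huv.1 huv.2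

/-- If there are `k` arc-disjoint cycles, then there are `k` short ones in the kernel. -/
theorem IsHub.exists_packing (hS : IsHub D S) (hD : IsTournament D) {k : ℕ}
    (h : HasArcDisjointCycles D k) :
    ∃ C : Fin k → List V, IsPacking D C ∧ (∀ i, (C i).length ≤ 2 * k + 3) ∧
      ∀ i, ∀ u ∈ C i, u ∈ S ∨ (classBelow D S u).card < k * (2 * k + 3) := by
  classical
  obtain ⟨C, hC, hlen⟩ := exists_short_packing hD h
  set U : Finset V := Finset.univ.biUnion fun i => (C i).toFinset with hUdef
  have hU : U.card ≤ k * (2 * k + 3) := by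
    refine Finset.card_biUnion_le.trans ((Finset.sum_le_card_nsmul _ _ (2 * k + 3)
      fun i _ => (List.toFinset_card_le _).trans (hlen i)).trans ?_)
    simp
  have hmem : ∀ i, ∀ u ∈ C i, u ∈ U := fun i u hu =>
    Finset.mem_biUnion.2 ⟨i, Finset.mem_univ _, List.mem_toFinset.2 hu⟩
  obtain ⟨φ, hφ, hadj⟩ := hS.exists_map hD U hU
  -- Distinct vertices are joined by an arc, whose image is an arc and hence not a loop.
  have hinj : ∀ u ∈ U, ∀ v ∈ U, φ u = φ v → u = v := fun u hu v hv huv => by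
    by_contra hne
    rcases hD.adj_or hne with h' | h'
    · exact hD.ne (hadj u hu v hv h') huv
    · exact hD.ne (hadj v hv u hu h') huv.symm
  refine ⟨fun i => (C i).map φ, ⟨fun i => ⟨?_, ?_, ?_⟩, fun i j hij => ?_⟩, fun i => ?_,
    fun i u hu => ?_⟩
  · simpa using (hC.1 i).1
  · exact (hC.1 i).2.1.map_on fun u hu v hv => hinj u (hmem i u hu) v (hmem i v hv)
  · intro e he
    rw [cycleArcs_map, List.mem_map] at he
    obtain ⟨e, he, rfl⟩ := he
    obtain ⟨h1, h2⟩ := mem_of_mem_cycleArcs he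
    exact hadj _ (hmem i _ h1) _ (hmem i _ h2) ((hC.1 i).2.2 e he)
  · intro e he he'
    rw [cycleArcs_map, List.mem_map] at he he'
    obtain ⟨e, he, rfl⟩ := he
    obtain ⟨e', he', hee'⟩ := he'
    obtain ⟨h1, h2⟩ := mem_of_mem_cycleArcs he
    obtain ⟨h1', h2'⟩ := mem_of_mem_cycleArcs he'
    have : e' = e := Prod.ext
      (hinj _ (hmem j _ h1') _ (hmem i _ h1) (congrArg Prod.fst hee'))
      (hinj _ (hmem j _ h2') _ (hmem i _ h2) (congrArg Prod.snd hee'))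
    exact hC.2 i j hij he (this ▸ he')
  · simpa using hlen i
  · obtain ⟨v, hv, rfl⟩ := List.mem_map.1 hu
    exact hφ v (hmem i v hv)

end Kernel

/-! ### Correctness of the algorithm -/

/-- The memory `m` holds the adjacency matrix of `D` and the table of the chosen triples. -/
def IsTable {n : ℕ} (D : Digraph (Fin n)) (m : ℕ → ℕ) : Prop :=
  (∀ u v : Fin n, MemAdj n m u v ↔ D.Adj u v) ∧
    ∀ t < n * n * n, m (n * n + t) ≠ 0 ↔ Choosable n m t

/-- Only the adjacency matrix and the bits of earlier triples are read, so one pass in increasing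
order carries out the greedy choice. -/
theorem choosable_congr {n t : ℕ} (ht : t < n * n * n) {m m' : ℕ → ℕ}
    (h : ∀ y < n * n + t, m y = m' y) : Choosable n m t ↔ Choosable n m' t := by
  have hn : 0 < n := Nat.pos_of_ne_zero fun h0 => by simp [h0] at ht
  have hb : t / n % n < n := Nat.mod_lt _ hn
  have hc : t % n < n := Nat.mod_lt _ hn
  have ha : t / n / n < n := by
    rw [Nat.div_lt_iff_lt_mul hn, Nat.div_lt_iff_lt_mul hn]; exact ht
  have hadj : ∀ u < n, ∀ v < n, (MemAdj n m u v ↔ MemAdj n m' u v) := fun u hu v hv => by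
    have : u * n + v < n * n := by nlinarith
    rw [MemAdj, MemAdj, h _ (by omega)]
  have hmark : ∀ v, Marked n m t v ↔ Marked n m' t v := fun v => by
    refine exists_congr fun i => and_congr_right fun hi => ?_
    rw [h _ (by omega)]
  rw [Choosable, Choosable, hadj _ ha _ hb, hadj _ hb _ hc, hadj _ hc _ ha, hmark, hmark, hmark]

theorem isTable_fillTable {n : ℕ} (D : Digraph (Fin n)) (k : ℕ) :
    IsTable D (fillTable (Choosable n) (n * n) (inputStore D k).mem (n * n * n)) := by
  refine ⟨fun u v => ?_, fun t ht => fillTable_iff (fun m m' => choosable_congr ht) ht⟩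
  have hlt : u.1 * n + v.1 < n * n := by
    have := u.2
    have := v.2
    nlinarith
  rw [MemAdj, fillTable_of_lt hlt]
  simp only [inputStore]
  constructor
  · intro h
    have h' : ∃ i j : Fin n, u.1 * n + v.1 = i.val * n + j.val ∧ D.Adj i j := by
      by_contra hno
      exact h (if_neg hno)
    obtain ⟨i, j, hij, hadj⟩ := h'
    have hn : 0 < n := u.pos
    have h1 := congrArg (· / n) hij
    have h2 := congrArg (· % n) hij
    simp only [mul_comm _ n, Nat.mul_add_div hn,
      Nat.div_eq_of_lt v.2, Nat.div_eq_of_lt j.2, Nat.mul_add_mod, Nat.mod_eq_of_lt v.2,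
      Nat.mod_eq_of_lt j.2, add_zero] at h1 h2
    rwa [Fin.ext h1, Fin.ext h2]
  · intro h
    rw [if_pos ⟨u, v, rfl, h⟩]
    exact one_ne_zero

theorem card_filter_range_eq {n : ℕ} (P : ℕ → Prop) [DecidablePred P] :
    ((Finset.range n).filter P).card = (Finset.univ.filter fun v : Fin n => P v).card := by
  symm
  refine Finset.card_bij (fun v _ => v.1) (fun v hv => ?_) (fun v _ w _ h => Fin.ext h)
    fun v hv => ?_
  · simpa using hv
  · simp only [Finset.mem_filter, Finset.mem_range] at hv
    exact ⟨⟨v, hv.1⟩, by simpa using hv.2, rfl⟩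

open Classical in
/-- The vertices in the chosen triples. -/
noncomputable def hub (n : ℕ) (m : ℕ → ℕ) : Finset (Fin n) :=
  Finset.univ.filter fun v => InHub n m v

theorem mem_hub {n : ℕ} {m : ℕ → ℕ} {v : Fin n} : v ∈ hub n m ↔ InHub n m v := by
  simp [hub]

theorem mem_cycleArcs_iff {V : Type*} {l : List V} {e : V × V} : e ∈ cycleArcs l ↔
    ∃ (j : ℕ) (_ : j < l.length) (_ : (j + 1) % l.length < l.length),
      e = (l[j], l[(j + 1) % l.length]) := by
  rw [cycleArcs, List.mem_iff_getElem]
  constructor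
  · rintro ⟨j, hj, rfl⟩
    have hj' : j < l.length := by simpa using hj
    refine ⟨j, hj', Nat.mod_lt _ (by omega), ?_⟩
    simp [List.getElem_rotate]
  · rintro ⟨j, hj, -, rfl⟩
    refine ⟨j, by simpa using hj, ?_⟩
    simp [List.getElem_rotate]

/-! ### The hub, the kernel and the packings as seen in the memory -/

section Table

variable {n : ℕ} {D : Digraph (Fin n)} {m : ℕ → ℕ}

/-- Greedy maximality: a triangle either was chosen, and lies in the hub, or was rejected because
two of its vertices were already marked. -/
theorem IsTable.isHub (h : IsTable D m) : IsHub D (hub n m) := by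
  intro a b c hab hbc hca
  simp only [mem_hub]
  set t := (a.1 * n + b.1) * n + c.1 with ht
  have hn : 0 < n := a.pos
  have hdiv : t / n = a.1 * n + b.1 := by
    rw [ht, mul_comm, Nat.mul_add_div hn, Nat.div_eq_of_lt c.2, add_zero]
  have hc : t % n = c.1 := by rw [ht, mul_comm, Nat.mul_add_mod, Nat.mod_eq_of_lt c.2]
  have ha : t / n / n = a.1 := by
    rw [hdiv, mul_comm, Nat.mul_add_div hn, Nat.div_eq_of_lt b.2, add_zero]
  have hb : t / n % n = b.1 := by rw [hdiv, mul_comm, Nat.mul_add_mod, Nat.mod_eq_of_lt b.2]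
  have htn : t < n * n * n := by
    have h1 : a.1 * n + b.1 + 1 ≤ n * n := by
      have := a.2
      have := b.2
      nlinarith
    have h2 := Nat.mul_le_mul_right n h1
    have := c.2
    rw [Nat.add_mul] at h2
    omega
  have hmono : ∀ v, Marked n m t v → InHub n m v := fun v ⟨i, hi, hv⟩ => ⟨i, hi.trans htn, hv⟩
  by_cases hch : m (n * n + t) ≠ 0
  · exact .inl ⟨⟨t, htn, hch, .inl ha.symm⟩, ⟨t, htn, hch, .inr (.inl hb.symm)⟩⟩
  · rw [h.2 t htn, Choosable, ha, hb, hc, h.1, h.1, h.1] at hch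
    have := hmono a
    have := hmono b
    have := hmono c
    tauto

theorem IsTable.hubDegree_eq (h : IsTable D m) (u : Fin n) :
    hubDegree n m u = outDegreeTo D (hub n m) u := by
  classical
  rw [hubDegree, card_filter_range_eq, outDegreeTo, hub, Finset.filter_filter]
  simp only [h.1]

theorem IsTable.hubRank_eq (h : IsTable D m) (u : Fin n) :
    hubRank n m u = (classBelow D (hub n m) u).card := by
  classical
  rw [hubRank, card_filter_range_eq, classBelow]
  simp only [h.1, h.hubDegree_eq, mem_hub]

theorem IsTable.kept_iff (h : IsTable D m) {M : ℕ} (u : Fin n) :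
    Kept n m M u ↔ u ∈ hub n m ∨ (classBelow D (hub n m) u).card < M := by
  rw [Kept, h.hubRank_eq, mem_hub]

theorem card_hub_le : (hub n m).card ≤ 3 * chosenCount n m := by
  classical
  rw [hub, ← card_filter_range_eq (InHub n m), chosenCount, mul_comm]
  refine (Finset.card_le_card (t := ((Finset.range (n * n * n)).filter fun t =>
    m (n * n + t) ≠ 0).biUnion fun t => {t / n / n, t / n % n, t % n}) fun v hv => ?_).trans
      (Finset.card_biUnion_le_card_mul _ _ _ fun t _ => Finset.card_le_three)
  obtain ⟨t, ht, hch, hv⟩ := (Finset.mem_filter.1 hv).2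
  refine Finset.mem_biUnion.2 ⟨t, Finset.mem_filter.2 ⟨Finset.mem_range.2 ht, hch⟩, ?_⟩
  simpa [InTriple] using hv

/-- A bound on the size of the kernel. -/
def kernelBound (k : ℕ) : ℕ := 3 * k + (3 * k + 1) * vertexBound k

theorem IsTable.kernelSize_le (h : IsTable D m) (hD : IsTournament D) {k : ℕ}
    (hk : chosenCount n m < k) : kernelSize n m k ≤ kernelBound k := by
  classical
  have hcard : (hub n m).card ≤ 3 * k := by
    have := card_hub_le (n := n) (m := m)
    omega
  have := h.isHub.card_kernel_le hD (vertexBound k)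
  rw [kernelSize, keptCount, card_filter_range_eq, kernelBound]
  refine (Finset.card_le_card fun u hu => ?_).trans (this.trans (add_le_add hcard (Nat.mul_le_mul_right _ (Nat.succ_le_succ hcard))))
  simpa [h.kept_iff] using hu

/-- The chosen triples are arc-disjoint triangles. -/
theorem IsTable.hasArcDisjointCycles (h : IsTable D m) (hD : IsTournament D) {k : ℕ}
    (hk : k ≤ chosenCount n m) : HasArcDisjointCycles D k := by
  classical
  obtain ⟨A, hA, hAk⟩ := Finset.exists_subset_card_eq (show k ≤ _ from hk)
  let f := (A.equivFinOfCardEq hAk).symm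
  have hf : ∀ i, (f i).1 < n * n * n ∧ Choosable n m (f i).1 := fun i => by
    have := Finset.mem_filter.1 (hA (f i).2)
    have ht := Finset.mem_range.1 this.1
    exact ⟨ht, (h.2 _ ht).1 this.2⟩
  have hlt : ∀ i, (f i).1 / n / n < n ∧ (f i).1 / n % n < n ∧ (f i).1 % n < n := fun i => by
    have hn : 0 < n := Nat.pos_of_ne_zero fun h0 => by simpa [h0] using (hf i).1
    refine ⟨?_, Nat.mod_lt _ hn, Nat.mod_lt _ hn⟩
    rw [Nat.div_lt_iff_lt_mul hn, Nat.div_lt_iff_lt_mul hn]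
    exact (hf i).1
  let C : Fin k → List (Fin n) := fun i =>
    [⟨_, (hlt i).1⟩, ⟨_, (hlt i).2.1⟩, ⟨_, (hlt i).2.2⟩]
  have harcs : ∀ i, ∀ e : Fin n × Fin n, e ∈ cycleArcs (C i) ↔
      e = (⟨_, (hlt i).1⟩, ⟨_, (hlt i).2.1⟩) ∨ e = (⟨_, (hlt i).2.1⟩, ⟨_, (hlt i).2.2⟩) ∨
      e = (⟨_, (hlt i).2.2⟩, ⟨_, (hlt i).1⟩) := fun i e => by
    simp [C, cycleArcs]
  have hadj : ∀ i, ∀ e ∈ cycleArcs (C i), D.Adj e.1 e.2 := fun i e he => by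
    obtain ⟨⟨h1, h2, h3⟩, -⟩ := (hf i).2
    rcases (harcs i e).1 he with rfl | rfl | rfl
    · exact (h.1 _ _).1 h1
    · exact (h.1 _ _).1 h2
    · exact (h.1 _ _).1 h3
  -- A common arc would have both ends marked when the later triple was examined, and that triple
  -- would have been rejected.
  have hdis : ∀ i j, (f i).1 < (f j).1 → List.Disjoint (cycleArcs (C i)) (cycleArcs (C j)) := by
    intro i j hij e he he'
    have hch : m (n * n + (f i).1) ≠ 0 := (Finset.mem_filter.1 (hA (f i).2)).2
    have hin : InTriple n (f i).1 e.1 ∧ InTriple n (f i).1 e.2 := by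
      rcases (harcs i e).1 he with rfl | rfl | rfl <;> simp [InTriple]
    have h1 : Marked n m (f j).1 e.1 := ⟨_, hij, hch, hin.1⟩
    have h2 : Marked n m (f j).1 e.2 := ⟨_, hij, hch, hin.2⟩
    obtain ⟨-, hab, hbc, hac⟩ := (hf j).2
    rcases (harcs j e).1 he' with rfl | rfl | rfl
    · exact hab ⟨h1, h2⟩
    · exact hbc ⟨h1, h2⟩
    · exact hac ⟨h2, h1⟩
  refine ⟨C, fun i => ⟨by simp [C], ?_, hadj i⟩, fun i j hij => ?_⟩
  · have e1 := hD.ne (hadj i _ ((harcs i _).2 (.inl rfl)))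
    have e2 := hD.ne (hadj i _ ((harcs i _).2 (.inr (.inl rfl))))
    have e3 := hD.ne (hadj i _ ((harcs i _).2 (.inr (.inr rfl))))
    simp only [C, List.nodup_cons, List.mem_cons, List.not_mem_nil, or_false, not_or]
    exact ⟨⟨e1, e3.symm⟩, e2, not_false, List.nodup_nil⟩
  · have hne : (f i).1 ≠ (f j).1 := fun h => hij (f.injective (Subtype.ext h))
    rcases lt_or_gt_of_ne hne with h' | h'
    · exact hdis i j h'
    · exact (hdis j i h').symm

/-! ### Descriptions of packings -/

theorem IsTable.hasArcDisjointCycles_of_describes (h : IsTable D m) {k l : ℕ} {r : ℕ → ℕ}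
    {w : ℕ → ℕ → ℕ} (hdesc : Describes n m k l r w) : HasArcDisjointCycles D k := by
  let C : Fin k → List (Fin n) := fun i =>
    List.ofFn fun j : Fin (r i) => ⟨w i j, ((hdesc i i.2).2 j j.2).1.1⟩
  have harcs : ∀ i : Fin k, ∀ e ∈ cycleArcs (C i), ∃ j < r i,
      e.1.1 = w i j ∧ e.2.1 = w i ((j + 1) % r i) := by
    intro i e he
    obtain ⟨j, hj, hj', rfl⟩ := mem_cycleArcs_iff.1 he
    refine ⟨j, by simpa [C] using hj, ?_, ?_⟩ <;> simp [C]
  refine ⟨C, fun i => ⟨?_, ?_, fun e he => ?_⟩, fun i j hij => ?_⟩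
  · have := (hdesc i i.2).1.1
    rw [← List.length_pos_iff]
    simpa [C] using this
  · refine List.nodup_ofFn.2 fun a b hab => ?_
    have hab' : w i a = w i b := congrArg Fin.val hab
    by_contra hne
    rcases lt_or_gt_of_ne (fun h => hne (Fin.ext h) : a.1 ≠ b.1) with h' | h'
    · exact ((hdesc i i.2).2 b b.2).2.1 a h' hab'.symm
    · exact ((hdesc i i.2).2 a a.2).2.1 b h' hab'
  · obtain ⟨j, hj, h1, h2⟩ := harcs i e he
    rw [← h.1, h1, h2]
    exact ((hdesc i i.2).2 j hj).1.2
  · wlog hlt : j.1 < i.1 generalizing i j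
    · exact (this j i hij.symm (by have := fun h => hij (Fin.ext h); omega)).symm
    intro e he he'
    obtain ⟨a, ha, h1, h2⟩ := harcs i e he
    obtain ⟨b, hb, h1', h2'⟩ := harcs j e he'
    exact ((hdesc i i.2).2 a ha).2.2 j hlt b hb ⟨h1.symm.trans h1', h2.symm.trans h2'⟩

theorem IsTable.describes (h : IsTable D m) {k l : ℕ} {C : Fin k → List (Fin n)}
    (hC : IsPacking D C) (hl : ∀ i, (C i).length ≤ l) {r : ℕ → ℕ} {w : ℕ → ℕ → ℕ}
    (hr : ∀ i : Fin k, r i = (C i).length)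
    (hw : ∀ (i : Fin k) (j : ℕ) (hj : j < (C i).length), w i j = ((C i)[j] : Fin n)) :
    Describes n m k l r w := by
  have key : ∀ (i : Fin k) (j : ℕ) (hj : j < r i), ∃ e ∈ cycleArcs (C i),
      w i j = e.1 ∧ w i ((j + 1) % r i) = e.2 := by
    intro i j hj
    rw [hr] at hj ⊢
    have hj' : (j + 1) % (C i).length < (C i).length := Nat.mod_lt _ (by omega)
    exact ⟨((C i)[j], (C i)[(j + 1) % (C i).length]), mem_cycleArcs_iff.2 ⟨j, hj, hj', rfl⟩,
      hw i j hj, hw i _ hj'⟩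
  intro i hi
  obtain ⟨hne, hnd, hadj⟩ := hC.1 ⟨i, hi⟩
  have hri := hr ⟨i, hi⟩
  dsimp only at hri
  refine ⟨⟨hri ▸ List.length_pos_iff.2 hne, hri ▸ hl _⟩, fun j hj => ⟨?_, fun j' hj' => ?_,
    fun i' hi' j' hj' => ?_⟩⟩
  · obtain ⟨e, he, h1, h2⟩ := key ⟨i, hi⟩ j hj
    dsimp only at h1 h2
    rw [h1, h2]
    exact ⟨e.1.2, (h.1 _ _).2 (hadj e he)⟩
  · have h1 := hw ⟨i, hi⟩ j (hri ▸ hj)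
    have h2 := hw ⟨i, hi⟩ j' (hri ▸ hj'.trans hj)
    dsimp only at h1 h2
    rw [h1, h2]
    intro heq
    exact hj'.ne' ((List.Nodup.getElem_inj_iff hnd).1 (Fin.ext heq))
  · rintro ⟨hx, hy⟩
    obtain ⟨e, he, h1, h2⟩ := key ⟨i, hi⟩ j hj
    obtain ⟨e', he', h1', h2'⟩ := key ⟨i', hi'.trans hi⟩ j' hj'
    have : e = e' := Prod.ext (Fin.ext (h1.symm.trans (hx.trans h1')))
      (Fin.ext (h2.symm.trans (hy.trans h2')))
    exact hC.2 ⟨i, hi⟩ ⟨i', hi'.trans hi⟩ (fun h => hi'.ne' (congrArg Fin.val h)) he (this ▸ he')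

/-- Horner's scheme, with the least significant digit split off. -/
theorem exists_digits {N : ℕ} (p : ℕ) (δ : ℕ → ℕ) (hδ : ∀ x < p, δ x < N) :
    ∃ c < N ^ p, ∀ x < p, digit N c x = δ x := by
  induction p generalizing δ with
  | zero => exact ⟨0, by simp, by simp⟩
  | succ p ih =>
    obtain ⟨c, hc, hd⟩ := ih (fun x => δ (x + 1)) fun x hx => hδ _ (by omega)
    have h0 := hδ 0 (by omega)
    have hN : 0 < N := by omega
    refine ⟨N * c + δ 0, ?_, fun x hx => ?_⟩
    · have := Nat.mul_le_mul_left N (Nat.succ_le_of_lt hc)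
      rw [pow_succ, mul_comm (N ^ p)]
      rw [Nat.mul_succ] at this
      omega
    · rcases x with _ | x
      · simp [digit, Nat.mod_eq_of_lt h0]
      · rw [← hd x (by omega), digit, digit, pow_succ', ← Nat.div_div_eq_div_mul,
          Nat.mul_add_div hN, Nat.div_eq_of_lt h0, add_zero]

theorem keptCount_lt {M u v : ℕ} (hu : Kept n m M u) (huv : u < v) :
    keptCount n m M u < keptCount n m M v := by
  classical
  refine Finset.card_lt_card ((Finset.ssubset_iff_of_subset fun w hw => ?_).2 ⟨u, ?_, ?_⟩)
  · simp only [Finset.mem_filter, Finset.mem_range] at hw ⊢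
    exact ⟨hw.1.trans huv, hw.2⟩
  · simp [huv, hu]
  · simp

/-- `keptCount` is strictly increasing on kept vertices, so the sum defining `keptNth` has a single
relevant term. -/
theorem keptNth_keptCount {M u : ℕ} (hu : Kept n m M u) (hun : u < n) :
    keptNth n m M (keptCount n m M u) = u := by
  rw [keptNth, Finset.sum_eq_single u]
  · simp [hu]
  · intro v _ hvu
    rw [if_neg]
    rintro ⟨hv, h⟩
    rcases lt_or_gt_of_ne hvu with h' | h'
    · exact (keptCount_lt hv h').ne h
    · exact (keptCount_lt hu h').ne' h
  · simp [hun]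

/-- A code is checked against the whole tournament, so soundness needs no kernel; the kernel and the
length bound are needed for completeness. -/
theorem IsTable.hasCode_iff (h : IsTable D m) (hD : IsTournament D) {k : ℕ} :
    HasCode n m k ↔ HasArcDisjointCycles D k := by
  classical
  refine ⟨fun ⟨c, _, hc⟩ => h.hasArcDisjointCycles_of_describes hc, fun hcyc => ?_⟩
  obtain ⟨C, hC, hlen, hkern⟩ := h.isHub.exists_packing hD hcyc
  set M := vertexBound k with hM
  have hkept : ∀ i, ∀ u ∈ C i, Kept n m M u := fun i u hu => (h.kept_iff u).2 (hkern i u hu)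
  -- The length minus one must itself be a digit in base `kernelSize`; it is, as a cycle consists of
  -- distinct kernel vertices.
  have hlenN : ∀ i, (C i).length ≤ kernelSize n m k := fun i => by
    rw [kernelSize, keptCount, card_filter_range_eq, ← List.toFinset_card_of_nodup (hC.1 i).2.1]
    exact Finset.card_le_card fun u hu =>
      Finset.mem_filter.2 ⟨Finset.mem_univ _, hkept i u (List.mem_toFinset.1 hu)⟩
  -- Each cycle owns a block of `cycleBound k + 1` digits: its length minus one, the kernel indices
  -- of its vertices, and zeros as padding.
  let δ : ℕ → ℕ := fun x =>
    if hx : x / (cycleBound k + 1) < k then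
      if x % (cycleBound k + 1) = 0 then (C ⟨_, hx⟩).length - 1
      else if hy : x % (cycleBound k + 1) - 1 < (C ⟨_, hx⟩).length then
        keptCount n m M ((C ⟨_, hx⟩)[x % (cycleBound k + 1) - 1] : Fin n)
      else 0
    else 0
  have hδ : ∀ x < digitCount k, δ x < kernelSize n m k := by
    intro x hx
    have hx' : x / (cycleBound k + 1) < k := (Nat.div_lt_iff_lt_mul (Nat.succ_pos _)).2 hx
    have h1 := hlenN ⟨_, hx'⟩
    have h2 := List.length_pos_iff.2 (hC.1 ⟨_, hx'⟩).1
    simp only [δ, dif_pos hx']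
    split_ifs with hy hz
    · omega
    · exact keptCount_lt (hkept _ _ (List.getElem_mem _)) (Fin.is_lt _)
    · omega
  obtain ⟨c, hc, hdig⟩ := exists_digits _ δ hδ
  have hpos : ∀ i < k, ∀ y ≤ cycleBound k, i * (cycleBound k + 1) + y < digitCount k ∧
      (i * (cycleBound k + 1) + y) / (cycleBound k + 1) = i ∧
      (i * (cycleBound k + 1) + y) % (cycleBound k + 1) = y := by
    intro i hi y hy
    refine ⟨?_, ?_, ?_⟩
    · have := Nat.mul_le_mul_right (cycleBound k + 1) (Nat.succ_le_of_lt hi)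
      rw [Nat.succ_mul] at this
      rw [digitCount]
      omega
    · rw [mul_comm, Nat.mul_add_div (Nat.succ_pos _), Nat.div_eq_of_lt (by omega), add_zero]
    · rw [mul_comm, Nat.mul_add_mod, Nat.mod_eq_of_lt (by omega)]
  refine ⟨c, hc, h.describes hC hlen (fun i => ?_) fun i j hj => ?_⟩
  · obtain ⟨h1, h2, h3⟩ := hpos i i.2 0 (Nat.zero_le _)
    rw [add_zero] at h1 h2 h3
    have := List.length_pos_iff.2 (hC.1 i).1
    rw [codeLength, hdig _ h1]
    simp only [δ, h2, h3, Fin.is_lt, dif_pos, if_true, Fin.eta]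
    omega
  · have hj' : 1 + j ≤ cycleBound k := by
      have := hlen i
      have : j + 1 ≤ 2 * k + 3 := by omega
      rw [cycleBound]
      omega
    obtain ⟨h1, h2, h3⟩ := hpos i i.2 (1 + j) hj'
    have hval : δ (i.1 * (cycleBound k + 1) + (1 + j)) = keptCount n m M ((C i)[j] : Fin n) := by
      simp only [δ, h2, h3, Fin.is_lt, dif_pos, Fin.eta, Nat.add_sub_cancel_left, hj]
      simp
    rw [codeVertex, hdig _ h1, hval]
    exact keptNth_keptCount (hkept i _ (List.getElem_mem _)) (Fin.is_lt _)

end Table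

/-! ### The running time -/

/-- A bound on the number of candidate descriptions. -/
def codeBound (k : ℕ) : ℕ := kernelBound k ^ digitCount k

/-- An exponent `h` with `k + codeBound k + 1 ≤ 2 ^ h`. -/
def timeExponent (k : ℕ) : ℕ :=
  (6 + 3 * (Nat.log 2 (k + 1) + 1)) * digitCount k + (Nat.log 2 (k + 1) + 1) + 1

/-- The bound is a cubic polynomial, at most 2 ^ 6 * (k + 1) ^ 3. -/
theorem kernelBound_le (k : ℕ) : kernelBound k ≤ 2 ^ (6 + 3 * (Nat.log 2 (k + 1) + 1)) := by
  have h1 : k + 1 ≤ 2 ^ (Nat.log 2 (k + 1) + 1) := (Nat.lt_pow_succ_log_self (by norm_num) _).le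
  have h2 : (k + 1) ^ 3 ≤ 2 ^ (3 * (Nat.log 2 (k + 1) + 1)) := by
    rw [mul_comm, pow_mul]
    exact Nat.pow_le_pow_left h1 3
  rw [pow_add]
  refine le_trans ?_ (Nat.mul_le_mul_left _ h2)
  rw [kernelBound, vertexBound, cycleBound]
  ring_nf
  nlinarith [Nat.zero_le k, Nat.zero_le (k ^ 2), Nat.zero_le (k ^ 3)]

theorem codeBound_le (k : ℕ) : k + codeBound k + 1 ≤ 2 ^ timeExponent k := by
  have h1 : k + 1 ≤ 2 ^ (Nat.log 2 (k + 1) + 1) := (Nat.lt_pow_succ_log_self (by norm_num) _).le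
  have h2 : codeBound k ≤ 2 ^ ((6 + 3 * (Nat.log 2 (k + 1) + 1)) * digitCount k) := by
    rw [codeBound, pow_mul]
    exact Nat.pow_le_pow_left (kernelBound_le k) _
  have h3 : 0 < 2 ^ (Nat.log 2 (k + 1) + 1) := by positivity
  have h4 : 0 < 2 ^ ((6 + 3 * (Nat.log 2 (k + 1) + 1)) * digitCount k) := by positivity
  rw [timeExponent, pow_succ, pow_add]
  nlinarith

theorem isBigO_timeExponent (q : ℕ) : (fun k : ℕ => ((q * timeExponent k : ℕ) : ℝ)) =O[atTop]
    fun k : ℕ => (k : ℝ) ^ 2 * Real.log (k : ℝ) := by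
  refine IsBigO.of_bound (q * 500) ?_
  -- From 3 onwards log k ≥ 1, so constants are absorbed; the factor 500 is generous.
  filter_upwards [eventually_ge_atTop 3] with k hk
  have hk' : (3 : ℝ) ≤ k := by exact_mod_cast hk
  have hlog1 : 1 ≤ Real.log k := by
    rw [Real.le_log_iff_exp_le (by linarith)]
    linarith [Real.exp_one_lt_d9]
  set L := Nat.log 2 (k + 1) with hL
  have hLlog : (L : ℝ) ≤ 3 * Real.log k := by
    have h1 : (2 : ℝ) ^ L ≤ k + 1 := by
      exact_mod_cast Nat.pow_log_le_self 2 (Nat.succ_ne_zero k)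
    have h2 : (L : ℝ) * Real.log 2 ≤ Real.log (k + 1) := by
      rw [← Real.log_pow]
      exact Real.log_le_log (by positivity) h1
    have h3 : Real.log (k + 1) ≤ 2 * Real.log k := by
      rw [← Nat.cast_two, ← Real.log_pow]
      exact Real.log_le_log (by positivity) (by nlinarith)
    have h4 := Real.log_two_gt_d9
    have h5 : (0 : ℝ) ≤ L := Nat.cast_nonneg _
    nlinarith
  have hbound : (timeExponent k : ℝ) ≤ 500 * (k ^ 2 * Real.log k) := by
    simp only [timeExponent, digitCount, cycleBound, ← hL]
    push_cast
    have hq : (k : ℝ) * (2 * k + 3 + 1) ≤ 4 * k ^ 2 := by nlinarith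
    have hc : (6 + 3 * ((L : ℝ) + 1)) ≤ 18 * Real.log k := by linarith
    have h0 : 0 ≤ (k : ℝ) * (2 * k + 3 + 1) := by positivity
    have hm : (6 + 3 * ((L : ℝ) + 1)) * (k * (2 * k + 3 + 1)) ≤
        (18 * Real.log k) * (4 * k ^ 2) :=
      mul_le_mul hc hq h0 (by linarith)
    have hk2 : (1 : ℝ) ≤ k ^ 2 := by nlinarith
    have : Real.log k ≤ k ^ 2 * Real.log k := by nlinarith
    nlinarith
  have hnn : (0 : ℝ) ≤ k ^ 2 * Real.log k := by positivity
  rw [Real.norm_of_nonneg (by positivity), Real.norm_of_nonneg hnn]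
  push_cast
  calc (q : ℝ) * timeExponent k ≤ q * (500 * (k ^ 2 * Real.log k)) :=
        mul_le_mul_of_nonneg_left hbound (Nat.cast_nonneg _)
    _ = q * 500 * (k ^ 2 * Real.log k) := by ring

/-! ### The program -/

/-- The states of the brute force phase. -/
abbrev KernelState : Type :=
  {a : ℕ × ℕ × BitMem // kernelSize a.1 a.2.2.1 a.2.1 ≤ kernelBound a.2.1}

/-- The context of the brute force phase. -/
def kernelCtx : Ctx KernelState where
  m := 2
  var a x := if x = 0 then a.1.1 else a.1.2.1
  mem a := a.1.2.2.1
  size a := a.1.1 + a.1.2.1 + codeBound a.1.2.1 + 1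
  var_le _ _ _ := by split_ifs <;> omega
  mem_le a y := (a.1.2.2.2 y).trans (by omega)

/-- The restriction to states with a small kernel bounds the number of codes by `codeBound`, which
is part of the size. -/
theorem compP_hasCode :
    CompP kernelCtx fun a => HasCode a.1.1 a.1.2.2.1 a.1.2.1 := by
  have hN : Comp kernelCtx fun a => a.1.1 := Comp.var (Γ := kernelCtx) (x := 0) (by decide)
  have hK : Comp kernelCtx fun a => a.1.2.1 := Comp.var (Γ := kernelCtx) (x := 1) (by decide)
  refine CompP.hasCode hN hK (PolyBdd.mono PolyBdd.size fun a => ?_)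
  have := Nat.pow_le_pow_left a.2 (digitCount a.1.2.1)
  change _ ≤ a.1.1 + a.1.2.1 + codeBound a.1.2.1 + 1
  change _ ≤ codeBound a.1.2.1 at this
  exact this.trans (by omega)

theorem compP_le_chosenCount :
    CompP instanceCtx fun a => a.2.1 ≤ chosenCount a.1 a.2.2.1 :=
  CompP.le (Comp.var (Γ := instanceCtx) (x := 1) (by decide))
    (Comp.chosenCount (Γ := instanceCtx) (Comp.var (Γ := instanceCtx) (x := 0) (by decide)))

theorem exists_chooseTriples : ∃ (p : Prog) (q : ℕ), ∀ (n : ℕ) (s : Store), s.reg 0 = n →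
    (∀ y, s.mem y ≤ 1) → Does p s ((n + 3) ^ q) fun s' =>
      s'.mem = fillTable (Choosable n) (n * n) s.mem (n * n * n) ∧
        s'.reg 0 = n ∧ s'.reg 1 = s.reg 1 := by
  have hN : Comp vertexCtx fun a => a.1 := Comp.var (Γ := vertexCtx) (x := 0) (by decide)
  exact exists_fillTable (e := fun n => n * n * n) (b := fun n => n * n) ((hN.mul hN).mul hN)
    (hN.mul hN) (CompP.choosable (Γ := vertexCtx.ext) hN.weaken Comp.top)

open Classical in
theorem exists_solver : ∃ (p : Prog) (q : ℕ), ∀ (n : ℕ) (D : Digraph (Fin n)) (k : ℕ),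
    IsTournament D →
      Does p (inputStore D k) (3 * ((n + k + codeBound k + 5) ^ q) + 4) fun s =>
        s.reg 0 = if HasArcDisjointCycles D k then 1 else 0 := by
  obtain ⟨p₁, q₁, hp₁⟩ := exists_chooseTriples
  obtain ⟨-, T₂, ⟨q₂, hT₂⟩, hp₂⟩ := compP_le_chosenCount
  obtain ⟨-, T₃, ⟨q₃, hT₃⟩, hp₃⟩ := compP_hasCode
  obtain ⟨p₂, hp₂⟩ := hp₂ 2 id fun x hx => hx
  obtain ⟨p₃, hp₃⟩ := hp₃ 2 id fun x hx => hx
  refine ⟨.seq p₁ (.seq p₂ (.ite 2 (.instr (.const 0 1))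
    (.seq p₃ (.seq (.instr (.const 0 0)) (.instr (.add 0 0 2)))))), q₁ + q₂ + q₃,
    fun n D k hD => ?_⟩
  set W := n + k + codeBound k + 5 with hW
  have hpow : ∀ {x q : ℕ}, x ≤ W → q ≤ q₁ + q₂ + q₃ → x ^ q ≤ W ^ (q₁ + q₂ + q₃) :=
    fun hx hq => (Nat.pow_le_pow_left hx _).trans (Nat.pow_le_pow_right (by omega) hq)
  have hbits : ∀ y, (inputStore D k).mem y ≤ 1 := fun y => by
    simp only [inputStore]
    split_ifs <;> omega
  set m := fillTable (Choosable n) (n * n) (inputStore D k).mem (n * n * n) with hm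
  have hmbits : ∀ y, m y ≤ 1 := fillTable_le hbits _
  have htab : IsTable D m := isTable_fillTable D k
  refine Does.mono (T := W ^ (q₁ + q₂ + q₃) + (W ^ (q₁ + q₂ + q₃) +
    (W ^ (q₁ + q₂ + q₃) + (1 + 1) + 1))) (Does.seq ((hp₁ n _ rfl hbits).mono
      (hpow (by omega) (by omega)) fun s₁ h₁ => Does.seq ?_)) (by omega) fun _ h => h
  obtain ⟨hmem, h0, h1⟩ := h₁
  have h1' : s₁.reg 1 = k := h1
  have hmatch : ∀ x < 2, s₁.reg (id x) = if x = 0 then n else k := fun x hx => by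
    obtain rfl | rfl : x = 0 ∨ x = 1 := by omega
    · simpa using h0
    · simpa using h1'
  refine (hp₂ (n, k, ⟨m, hmbits⟩) s₁ ⟨hmatch, hmem⟩).mono ?_ fun s₂ h₂ => Does.ite ?_ ?_
  · refine (hT₂ _).trans (hpow ?_ (by omega))
    change n + k + 1 + 2 ≤ W
    omega
  · intro hne
    have hle : k ≤ chosenCount n m := by
      by_contra hno
      exact hne (h₂.1.trans (if_neg hno))
    refine (Does.instr ?_).mono (by omega : 1 ≤ _) fun _ h => h
    rw [if_pos (htab.hasArcDisjointCycles hD hle)]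
    simp [Instr.exec]
  · intro heq
    have hlt : chosenCount n m < k := by
      by_contra! hno
      exact one_ne_zero ((if_pos hno).symm.trans (h₂.1.symm.trans heq))
    -- The failed test, fewer than `k` chosen triples, is what places the state in `KernelState`.
    refine Does.seq (U := 1 + 1) ((hp₃ ⟨(n, k, ⟨m, hmbits⟩), htab.kernelSize_le hD hlt⟩ s₂
      ⟨fun x hx => (h₂.2.2 x hx).trans (hmatch x hx), h₂.2.1.trans hmem⟩).mono ?_ fun s₃ h₃ =>
        Does.seq (Does.instr (Does.instr ?_)))
    · refine (hT₃ _).trans (hpow ?_ (by omega))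
      change n + k + codeBound k + 1 + 2 ≤ W
      omega
    · simp only [Instr.exec, Function.update_self, zero_add]
      rw [Function.update_of_ne (by omega), h₃.1]
      simp only [htab.hasCode_iff hD]

end ArcPacking

theorem theorem4p3 :
    ∃ (p : ArcPacking.Prog) (g : ℕ → ℕ) (P : Polynomial ℕ),
      (fun k : ℕ => (g k : ℝ)) =O[atTop] (fun k : ℕ => (k : ℝ) ^ 2 * Real.log (k : ℝ)) ∧
        ArcPacking.SolvesACT p (fun n k => 2 ^ g k * P.eval n) := by
  classical
  obtain ⟨p, q, hp⟩ := ArcPacking.exists_solver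
  -- The factor 7 is 3 + 4: the additive 4 is absorbed by a power that is at least 1.
  refine ⟨p, fun k => q * ArcPacking.timeExponent k, 7 * (Polynomial.X + 5) ^ q,
    ArcPacking.isBigO_timeExponent q, fun n D k hD _ => ?_⟩
  obtain ⟨t, s, hr, ht, hs⟩ := hp n D k hD
  refine ⟨t, s, hr, ht.trans ?_, fun h => by rw [hs, if_pos h], fun h => by rw [hs, if_neg h]⟩
  have h1 := ArcPacking.codeBound_le k
  -- This separates the two parameters: the sum is at most (k + `codeBound k` + 1) * (n + 5).
  have h2 : n + k + ArcPacking.codeBound k + 5 ≤ 2 ^ ArcPacking.timeExponent k * (n + 5) := by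
    nlinarith
  have h3 := Nat.pow_le_pow_left h2 q
  rw [mul_pow, ← pow_mul, mul_comm _ q] at h3
  have h4 : 0 < (n + k + ArcPacking.codeBound k + 5) ^ q := by positivity
  have h5 : (7 * (Polynomial.X + 5) ^ q : Polynomial ℕ).eval n = 7 * (n + 5) ^ q := by
    simp
  beta_reduce
  rw [h5]
  calc 3 * (n + k + ArcPacking.codeBound k + 5) ^ q + 4
      ≤ 7 * (n + k + ArcPacking.codeBound k + 5) ^ q := by omega
    _ ≤ 7 * (2 ^ (q * ArcPacking.timeExponent k) * (n + 5) ^ q) := Nat.mul_le_mul_left _ h3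
    _ = _ := by ring
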